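/- Let $R=\mathbb{Z}[\alpha_1,\alpha_2]$ and $A=R[X]/((X-\alpha_1)(X-\alpha_2))$, the Frobenius algebra with comultiplication $\Delta(1)=(X-\alpha_1)\otimes 1+1\otimes(X-\alpha_2)$ and $\Delta(X-\alpha_i)=(X-\alpha_i)\otimes(X-\alpha_i)$. For an oriented link diagram $L$ let $C_\alpha(L)$ be the cochain complex of $R$-modules obtained by applying the associated two-dimensional TQFT to the cube of resolutions of $L$ (the resolution $v$ contributes $A^{\otimes\{\text{circles of }v\}}$ in homological degree $|v|-n_-$, where $|v|$ is the number of $1$-smoothings and $n_-$ is the number of negative crossings; the edges of the cube carry the multiplication and comultiplication maps with the usual signs), and let $\alpha(L)$ be its homology. For $j\in\{1,2\}$ and a point $p$ of $L$ that is not a crossing, let $\textcircled{j}_p:\alpha(L)\to\alpha(L)$ be the map induced by the chain map that on each resolution multiplies by $X-\alpha_j$ in the tensor factor of the circle through $p$. Theorem. Let $L$ be a link diagram, $c$ a crossing of $L$, and let $p$ and $q$ be points of $L$ on either side of $c$, that is, on two edges of the diagram that are opposite to each other at $c$ (the strand through $c$ leads from $p$ to $q$ and crosses nothing else in between). Then $$\textcircled{1}_p+\textcircled{2}_q=0$$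 as an endomorphism of $\alpha(L)$, in every homological degree. -/

import Mathlib

open scoped TensorProduct

/-! ### The Frobenius algebra -/

/-- The ground ring `ℤ[α₁, α₂]`; `α₁`, `α₂` are the variables with index `0`, `1`. -/
abbrev AlphaRing : Type := MvPolynomial (Fin 2) ℤ

/-- The algebra `ℤ[α₁, α₂][X] / ((X - α₁)(X - α₂))`. -/
abbrev AlphaAlg : Type :=
  AdjoinRoot ((Polynomial.X - Polynomial.C (MvPolynomial.X 0)) *
    (Polynomial.X - Polynomial.C (MvPolynomial.X 1)) : Polynomial AlphaRing)

/-- The shifted dots: `digit 0` is `X - α₁` (circled 1) and `digit 1` is `X - α₂` (circled 2). -/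
noncomputable def digit (j : Fin 2) : AlphaAlg :=
  AdjoinRoot.root _ - algebraMap AlphaRing AlphaAlg (MvPolynomial.X j)

/-- The element `Δ(1) = (X - α₁) ⊗ 1 + 1 ⊗ (X - α₂)`. -/
noncomputable def comulOne : AlphaAlg ⊗[AlphaRing] AlphaAlg :=
  digit 0 ⊗ₜ 1 + 1 ⊗ₜ digit 1

/-- The comultiplication `Δ(a) = (a ⊗ 1) Δ(1)`. -/
noncomputable def comul : AlphaAlg →ₗ[AlphaRing] AlphaAlg ⊗[AlphaRing] AlphaAlg :=
  LinearMap.mulRight AlphaRing comulOne ∘ₗ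
    (Algebra.TensorProduct.includeLeft :
      AlphaAlg →ₐ[AlphaRing] AlphaAlg ⊗[AlphaRing] AlphaAlg).toLinearMap

theorem digit_mul_digit : digit 0 * digit 1 = 0 := by
  have h := AdjoinRoot.eval₂_root ((Polynomial.X - Polynomial.C (MvPolynomial.X 0)) *
    (Polynomial.X - Polynomial.C (MvPolynomial.X 1)) : Polynomial AlphaRing)
  simpa [Polynomial.eval₂_mul, Polynomial.eval₂_sub, digit, AdjoinRoot.algebraMap_eq] using h

theorem digit_zero_sub_one : digit 0 - digit 1 =
    algebraMap AlphaRing AlphaAlg (MvPolynomial.X 1 - MvPolynomial.X 0) := by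
  simp only [digit, map_sub]; ring

theorem comulOne_symm : comulOne = digit 1 ⊗ₜ 1 + 1 ⊗ₜ digit 0 := by
  have h : (digit 0 - digit 1) ⊗ₜ[AlphaRing] (1 : AlphaAlg) =
      (1 : AlphaAlg) ⊗ₜ[AlphaRing] (digit 0 - digit 1) := by
    rw [digit_zero_sub_one, Algebra.algebraMap_eq_smul_one, TensorProduct.smul_tmul]
  rw [TensorProduct.sub_tmul, TensorProduct.tmul_sub] at h
  rw [comulOne]
  linear_combination h

theorem comul_one : comul 1 = comulOne := by
  simp [comul, ← Algebra.TensorProduct.one_def]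

theorem digit_tmul_mul_comulOne (j : Fin 2) :
    (digit j ⊗ₜ 1) * comulOne = digit j ⊗ₜ digit j ∧
    ((1 : AlphaAlg) ⊗ₜ digit j) * comulOne = digit j ⊗ₜ digit j := by
  have h' : digit 1 * digit 0 = 0 := by rw [mul_comm, digit_mul_digit]
  fin_cases j
  · constructor
    · rw [comulOne_symm]; simp [mul_add, digit_mul_digit]
    · rw [comulOne]; simp [mul_add, digit_mul_digit]
  · constructor
    · rw [comulOne]; simp [mul_add, h']
    · rw [comulOne_symm]; simp [mul_add, h']

theorem comul_digit (j : Fin 2) : comul (digit j) = digit j ⊗ₜ digit j := by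
  simpa [comul] using (digit_tmul_mul_comulOne j).1

theorem tmul_one_mul_comulOne (a : AlphaAlg) :
    (a ⊗ₜ 1) * comulOne = ((1 : AlphaAlg) ⊗ₜ a) * comulOne := by
  have ha : a ∈ Algebra.adjoin AlphaRing {(AdjoinRoot.root _ : AlphaAlg)} := by
    rw [AdjoinRoot.adjoinRoot_eq_top]; trivial
  induction ha using Algebra.adjoin_induction with
  | mem x hx =>
    rw [Set.mem_singleton_iff] at hx
    have h := (digit_tmul_mul_comulOne 0).1.trans (digit_tmul_mul_comulOne 0).2.symm
    have hx' : x = digit 0 + algebraMap AlphaRing AlphaAlg (MvPolynomial.X 0) := by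
      rw [hx, digit]; ring
    rw [hx', TensorProduct.add_tmul, TensorProduct.tmul_add, add_mul, add_mul, h,
      Algebra.algebraMap_eq_smul_one, TensorProduct.smul_tmul]
  | algebraMap r => rw [Algebra.algebraMap_eq_smul_one, TensorProduct.smul_tmul]
  | add x y _ _ hx hy => rw [TensorProduct.add_tmul, TensorProduct.tmul_add, add_mul, add_mul, hx, hy]
  | mul x y _ _ hx hy =>
    have h1 : (x * y) ⊗ₜ[AlphaRing] (1 : AlphaAlg) = (x ⊗ₜ 1) * (y ⊗ₜ 1) := by simp
    have h2 : (1 : AlphaAlg) ⊗ₜ[AlphaRing] (x * y) = (1 ⊗ₜ x) * (1 ⊗ₜ y) := by simp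
    rw [h1, h2, mul_assoc, hy, mul_left_comm, hx]; ring

theorem comul_mul_left (a b : AlphaAlg) : comul (a * b) = (a ⊗ₜ 1) * comul b := by
  have h1 : (a * b) ⊗ₜ[AlphaRing] (1 : AlphaAlg) = (a ⊗ₜ 1) * (b ⊗ₜ 1) := by simp
  change (a * b) ⊗ₜ[AlphaRing] (1 : AlphaAlg) * comulOne = (a ⊗ₜ 1) * ((b ⊗ₜ 1) * comulOne)
  rw [h1, mul_assoc]

theorem comul_mul_right (a b : AlphaAlg) : comul (a * b) = (1 ⊗ₜ a) * comul b := by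
  have : comul b = (b ⊗ₜ 1) * comulOne := by simp [comul]
  rw [comul_mul_left, this, mul_left_comm, tmul_one_mul_comulOne, mul_left_comm]

/-! ### Link diagrams -/

/-- A half-edge (dart) at a crossing. The four half-edges at a crossing are numbered
counterclockwise `0, 1, 2, 3`; `0` and `2` form the lower strand, `1` and `3` the upper one. -/
abbrev Dart (n : ℕ) : Type := Fin n × Fin 4

/-- Counterclockwise rotation about the crossings. -/
def rotate (n : ℕ) : Equiv.Perm (Dart n) := Equiv.prodCongr (Equiv.refl _) (Equiv.addRight 1)

/-- The number of cycles of a permutation, fixed points included. -/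
noncomputable def numCycles {D : Type} (π : Equiv.Perm D) : ℕ :=
  Nat.card (Quotient (Equiv.Perm.SameCycle.setoid π))

/-- The number of connected components of the 4-valent graph whose edges join `d` to `e d`. -/
noncomputable def numComponents {n : ℕ} (e : Equiv.Perm (Dart n)) : ℕ :=
  Nat.card (MulAction.orbitRel.Quotient (Subgroup.closure {rotate n, e}) (Dart n))

/-- An oriented link diagram in the plane (equivalently, the sphere), given by its planar diagram
code: `n` crossings, an involution `edge` that says which half-edges are glued together, a number of
crossingless closed components, and an orientation (`out d` means that the strand leaves the
crossing along `d`). Cycles of `rotate`, `edge` and `rotate * edge` are the vertices, edges and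
faces of the underlying 4-valent graph, and planarity is Euler's formula `V - E + F = 2 C`. -/
structure LinkDiagram where
  n : ℕ
  loops : ℕ
  edge : Equiv.Perm (Dart n)
  edge_edge : ∀ d, edge (edge d) = d
  edge_ne : ∀ d, edge d ≠ d
  out : Dart n → Bool
  out_edge : ∀ d, out (edge d) = !out d
  out_opposite : ∀ c i, out (c, i + 2) = !out (c, i)
  planar : (numCycles (rotate n) : ℤ) - numCycles edge + numCycles (rotate n * edge) =
    2 * numComponents edge

/-- The two smoothings of a crossing: the `0`-smoothing (`false`) joins `0` to `1` and `2` to `3`,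
the `1`-smoothing (`true`) joins `1` to `2` and `3` to `0`. -/
def smooth : Bool → Fin 4 → Fin 4
  | false => ![1, 0, 3, 2]
  | true => ![3, 2, 1, 0]

namespace LinkDiagram

variable (L : LinkDiagram)

/-- Positions on the diagram at which a digit may be placed: on a half-edge or on a crossingless
component. -/
abbrev Point : Type := Dart L.n ⊕ Fin L.loops

/-- A vertex of the cube of resolutions. -/
abbrev State : Type := Fin L.n → Bool

variable {L}

/-- Half-edges that are directly connected in the resolution `v`. -/
inductive Joined (v : L.State) : L.Point → L.Point → Prop
  | edge (d : Dart L.n) : Joined v (.inl d) (.inl (L.edge d))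
  | smoothing (c : Fin L.n) (i : Fin 4) :
      Joined v (.inl (c, i)) (.inl (c, smooth (v c) i))

/-- The circles of the resolution `v`. -/
abbrev Circle (v : L.State) : Type := Quotient (Relation.EqvGen.setoid (Joined v))

/-- The circle of the resolution `v` through a point. -/
def circle (v : L.State) (p : L.Point) : Circle v := Quotient.mk _ p

noncomputable instance (v : L.State) : Fintype (Circle v) := Fintype.ofFinite _

noncomputable instance (v : L.State) : DecidableEq (Circle v) := Classical.decEq _

/-- The tensor product of copies of `AlphaAlg`, one for each circle of the resolution `v`. -/
abbrev Chains (v : L.State) : Type := ⨂[AlphaRing] _ : Circle v, AlphaAlg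

/-- The inclusion of the tensor factor of the circle through `p`. -/
noncomputable def atPoint (v : L.State) (p : L.Point) : AlphaAlg →ₐ[AlphaRing] Chains v :=
  PiTensorProduct.singleAlgHom (R := AlphaRing) (A := fun _ : Circle v => AlphaAlg) (circle v p)

/-- The map between tensor powers induced by the saddle at the crossing `c`, from the resolution `v`
to the resolution `w` that differs from `v` only at `c`. If the two arcs at `c` lie on one circle of
`v`, the factor of that circle is comultiplied into the factors of the two circles of `w` through
these arcs; otherwise the factors of the two circles are multiplied. The other factors are carried
over identically. -/
noncomputable def saddle (c : Fin L.n) (v w : L.State) : Chains v →ₗ[AlphaRing] Chains w :=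
  PiTensorProduct.lift ((MultilinearMap.mkPiAlgebra AlphaRing (Circle v) (Chains w)).compLinearMap
    fun C => if circle v (.inl (c, 0)) = circle v (.inl (c, 2)) ∧ C = circle v (.inl (c, 0))
      then (Algebra.TensorProduct.productMap (atPoint w (.inl (c, 0)))
        (atPoint w (.inl (c, 2)))).toLinearMap ∘ₗ comul
      else (atPoint w C.out).toLinearMap)

/-- The sign of the edge of the cube that changes the crossing `c` of `v`. -/
noncomputable def edgeSign (v : L.State) (c : Fin L.n) : AlphaRing :=
  (-1) ^ (Finset.univ.filter fun b => b < c ∧ v b = true).card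

/-- The component of the differential from the summand at `v` to the summand at `w`. -/
noncomputable def component (v w : L.State) : Chains v →ₗ[AlphaRing] Chains w :=
  ∑ c, if v c = false ∧ w = Function.update v c true then edgeSign v c • saddle c v w else 0

/-- The number of negative crossings. -/
def numNegative (L : LinkDiagram) : ℕ :=
  (Finset.univ.filter fun c => L.out (c, 0) = L.out (c, 1)).card

/-- The homological degree of the summand at `v`. -/
def degree (v : L.State) : ℤ := (Finset.univ.filter fun c => v c = true).card - L.numNegative

/-! ### Circles and saddles -/

theorem circle_edge (v : L.State) (d : Dart L.n) :
    circle v (.inl (L.edge d)) = circle v (.inl d) :=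
  (Quotient.sound (Relation.EqvGen.rel _ _ (Joined.edge d))).symm

theorem circle_smoothing (v : L.State) (c : Fin L.n) (i : Fin 4) :
    circle v (.inl (c, smooth (v c) i)) = circle v (.inl (c, i)) :=
  (Quotient.sound (Relation.EqvGen.rel _ _ (Joined.smoothing c i))).symm

/-- The functions that are constant on circles are those that respect direct connections. -/
theorem eq_of_circle_eq {v : L.State} {α : Type*} (f : L.Point → α)
    (h1 : ∀ d, f (.inl (L.edge d)) = f (.inl d))
    (h2 : ∀ c i, f (.inl (c, smooth (v c) i)) = f (.inl (c, i)))
    {p q : L.Point} (h : circle v p = circle v q) : f p = f q := by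
  have h' : Relation.EqvGen (Joined v) p q := Quotient.exact h
  induction h' with
  | rel x y hxy => cases hxy with
    | edge d => exact (h1 d).symm
    | smoothing c i => exact (h2 c i).symm
  | refl => rfl
  | symm x y hxy ih => exact (ih (Quotient.sound hxy)).symm
  | trans x y z hxy hyz ih1 ih2 => exact (ih1 (Quotient.sound hxy)).trans (ih2 (Quotient.sound hyz))

end LinkDiagram

/-- Composing a permutation with the swap of two points merges or splits their cycles. -/
theorem sameCycle_swap_iff {D : Type} [Finite D] [DecidableEq D] (π π' : Equiv.Perm D) (S : Set D)
    (hS : ∀ d ∈ S, π d ∈ S) {p q : D} (hp : p ∈ S) (hpq : p ≠ q)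
    (hπ : ∀ d ∈ S, π' d = Equiv.swap p q (π d)) :
    π'.SameCycle p q ↔ ¬ π.SameCycle p q := by
  have key : ∀ σ : Equiv.Perm D, ∀ k : ℕ, 0 < k → (∀ j, 0 < j → j < k → (σ ^ j) p ≠ q) →
      (σ ^ k) p = p → ¬ σ.SameCycle p q := by
    intro σ k hk h1 h2 h
    obtain ⟨m, hm⟩ := h.exists_nat_pow_eq
    have h3 : (σ ^ (m % k)) p = q := by
      rw [← hm]
      conv_rhs => rw [← Nat.mod_add_div m k, pow_add, Equiv.Perm.mul_apply, pow_mul]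
      rw [Equiv.Perm.pow_apply_eq_self_of_apply_eq_self h2]
    rcases Nat.eq_zero_or_pos (m % k) with h0 | h0
    · rw [h0] at h3; exact hpq h3
    · exact h1 _ h0 (Nat.mod_lt _ hk) h3
  have hS' : ∀ j : ℕ, (π ^ j) p ∈ S := by
    intro j
    induction j with
    | zero => exact hp
    | succ j ih => rw [pow_succ', Equiv.Perm.mul_apply]; exact hS _ ih
  have hex : ∃ k : ℕ, 0 < k ∧ ((π ^ k) p = p ∨ (π ^ k) p = q) :=
    ⟨orderOf π, orderOf_pos π, Or.inl (by rw [pow_orderOf_eq_one]; rfl)⟩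
  classical
  obtain ⟨hk, hkpq⟩ := Nat.find_spec hex
  have hmin : ∀ j, 0 < j → j < Nat.find hex → (π ^ j) p ≠ p ∧ (π ^ j) p ≠ q := by
    intro j hj hjk
    have := Nat.find_min hex hjk
    tauto
  set k := Nat.find hex
  have hlt : ∀ j, j < k → (π' ^ j) p = (π ^ j) p := by
    intro j
    induction j with
    | zero => intro _; rfl
    | succ j ih =>
      intro hj
      rw [pow_succ', Equiv.Perm.mul_apply, ih (by omega), hπ _ (hS' j), ← Equiv.Perm.mul_apply π,
        ← pow_succ']
      exact Equiv.swap_apply_of_ne_of_ne (hmin _ (by omega) hj).1 (hmin _ (by omega) hj).2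
  have hkk : (π' ^ k) p = Equiv.swap p q ((π ^ k) p) := by
    obtain ⟨m, hm⟩ : ∃ m, k = m + 1 := ⟨k - 1, by omega⟩
    rw [hm, pow_succ', Equiv.Perm.mul_apply, hlt m (by omega), hπ _ (hS' m),
      ← Equiv.Perm.mul_apply π, ← pow_succ']
  rcases hkpq with h | h
  · rw [h, Equiv.swap_apply_left] at hkk
    exact iff_of_true ⟨k, by simpa using hkk⟩ (key π k hk (fun j h1 h2 => (hmin j h1 h2).2) h)
  · rw [h, Equiv.swap_apply_right] at hkk
    refine iff_of_false (key π' k hk (fun j h1 h2 => ?_) hkk) (not_not.2 ⟨k, by simpa using h⟩)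
    rw [hlt j h2]
    exact (hmin j h1 h2).2

namespace LinkDiagram

variable {L : LinkDiagram}

/-- Planarity gives a checkerboard colouring of the faces, hence a function on half-edges that
alternates along edges and around crossings. -/
theorem exists_alternating (L : LinkDiagram) : ∃ o : Dart L.n → ZMod 2,
    (∀ d, o (L.edge d) = o d + 1) ∧ (∀ d, o (rotate L.n d) = o d + 1) := by
  classical
  let K := ZMod 2
  have htwo : ∀ x : ZMod 2, x + x = 0 := CharTwo.add_self_eq_zero
  let Fa := Quotient (Equiv.Perm.SameCycle.setoid (rotate L.n * L.edge))
  let Ed := Quotient (Equiv.Perm.SameCycle.setoid L.edge)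
  let Ve := Quotient (Equiv.Perm.SameCycle.setoid (rotate L.n))
  let Co := MulAction.orbitRel.Quotient (Subgroup.closure {rotate L.n, L.edge}) (Dart L.n)
  let fa : Dart L.n → Fa := Quotient.mk _
  let ed : Dart L.n → Ed := Quotient.mk _
  let ve : Dart L.n → Ve := Quotient.mk _
  have fa_eq : ∀ d, fa (rotate L.n d) = fa (L.edge d) := by
    intro d
    refine Quotient.sound (s := Equiv.Perm.SameCycle.setoid _) ?_
    refine Equiv.Perm.SameCycle.symm ⟨1, ?_⟩
    simp [L.edge_edge]
  have ed_eq : ∀ d, ed (L.edge d) = ed d := by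
    intro d
    exact Quotient.sound (s := Equiv.Perm.SameCycle.setoid _) (Equiv.Perm.SameCycle.symm ⟨1, by simp⟩)
  have ve_eq : ∀ d, ve (rotate L.n d) = ve d := by
    intro d
    exact Quotient.sound (s := Equiv.Perm.SameCycle.setoid _) (Equiv.Perm.SameCycle.symm ⟨1, by simp⟩)
  -- functions constant on components
  have comp : ∀ (f : Dart L.n → K), (∀ d, f (rotate L.n d) = f d) → (∀ d, f (L.edge d) = f d) →
      ∃ g : Co → K, ∀ d, g (Quotient.mk _ d) = f d := by
    intro f h1 h2
    refine ⟨Quotient.lift f ?_, fun d => rfl⟩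
    rintro a b ⟨⟨g, hg⟩, rfl⟩
    have : ∀ x, f (g x) = f x := by
      induction hg using Subgroup.closure_induction with
      | mem x hx =>
        rcases hx with rfl | rfl
        · exact h1
        · exact h2
      | one => intro x; rfl
      | mul x y _ _ hx hy => intro z; rw [Equiv.Perm.mul_apply, hx, hy]
      | inv x _ hx => intro z; rw [← hx (x⁻¹ z)]; simp
    exact this b
  have edfun : ∀ (f : Dart L.n → K), (∀ d, f (L.edge d) = f d) →
      ∃ g : Ed → K, ∀ d, g (ed d) = f d := by
    intro f h2
    refine ⟨Quotient.lift f ?_, fun d => rfl⟩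
    rintro a b ⟨m, rfl⟩
    have : ∀ m : ℤ, ∀ x, f ((L.edge ^ m) x) = f x := by
      intro m
      induction m using Int.induction_on with
      | zero => intro x; rfl
      | succ i ih => intro x; rw [zpow_add_one, Equiv.Perm.mul_apply, ih, h2]
      | pred i ih =>
        intro x; rw [zpow_sub_one, Equiv.Perm.mul_apply, ih, ← h2 (L.edge⁻¹ x)]; simp
    exact (this m a).symm
  have T_spec : ∀ (g : Fa → K) (d : Dart L.n),
      g (fa (ed d).out) + g (fa (L.edge (ed d).out)) = g (fa d) + g (fa (L.edge d)) := by
    intro g d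
    obtain ⟨h, hh⟩ := edfun (fun d => g (fa d) + g (fa (L.edge d)))
      (fun d => by simp only [L.edge_edge]; ring)
    have h1 : ed (ed d).out = ed d := Quotient.out_eq _
    rw [← hh, ← hh, h1]
  -- the boundary map from faces to edges, and the one from edges to vertices
  let T : (Fa → K) →ₗ[K] (Ed → K) :=
    { toFun := fun g e => g (fa e.out) + g (fa (L.edge e.out))
      map_add' := by intro a b; ext d; simp only [Pi.add_apply]; ring
      map_smul' := by intro a b; ext d; simp only [Pi.smul_apply, smul_eq_mul, RingHom.id_apply]; ring }
  have hT : ∀ g d, T g (ed d) = g (fa d) + g (fa (L.edge d)) := T_spec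
  let Psi : (Ed → K) →ₗ[K] (Fin L.n → K) :=
    { toFun := fun b c => ∑ i, b (ed (c, i))
      map_add' := by intro a b; ext d; simp [Finset.sum_add_distrib]
      map_smul' := by
        intro a b; ext d; exact (Finset.mul_sum _ _ _).symm }
  have hPsi : ∀ b c, Psi b c = ∑ i, b (ed (c, i)) := fun b c => rfl
  have hle : LinearMap.range T ≤ LinearMap.ker Psi := by
    rintro _ ⟨g, rfl⟩
    rw [LinearMap.mem_ker]
    ext c
    rw [hPsi]
    simp only [hT, ← fa_eq, Finset.sum_add_distrib]
    have : ∑ i, g (fa (rotate L.n (c, i))) = ∑ i, g (fa (c, i)) :=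
      Equiv.sum_comp (Equiv.addRight (1 : Fin 4)) (fun i => g (fa (c, i)))
    rw [this]
    exact htwo _
  have hkerT : Module.finrank K (LinearMap.ker T) ≤ Nat.card Co := by
    let Q : (Co → K) →ₗ[K] (Fa → K) := LinearMap.funLeft K K (fun f => Quotient.mk _ f.out)
    have hQ : LinearMap.ker T ≤ LinearMap.range Q := by
      intro g hg
      have h2 : ∀ d, g (fa (L.edge d)) = g (fa d) := by
        intro d
        have := congrFun (LinearMap.mem_ker.1 hg) (ed d)
        rw [hT] at this
        exact (CharTwo.add_eq_zero.1 this).symm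
      obtain ⟨g', hg'⟩ := comp (fun d => g (fa d)) (fun d => by simp only [fa_eq, h2]) h2
      refine ⟨g', ?_⟩
      ext f
      have : fa f.out = f := Quotient.out_eq _
      change g' (Quotient.mk _ f.out) = g f
      rw [hg', this]
    calc Module.finrank K (LinearMap.ker T) ≤ Module.finrank K (LinearMap.range Q) :=
          Submodule.finrank_mono hQ
      _ ≤ Module.finrank K (Co → K) := LinearMap.finrank_range_le Q
      _ = Nat.card Co := by rw [Module.finrank_pi, Nat.card_eq_fintype_card]
  have hkerD : Module.finrank K (LinearMap.ker Psi.dualMap) ≤ Nat.card Co := by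
    let Q : (Co → K) →ₗ[K] Module.Dual K (Fin L.n → K) :=
      { toFun := fun g => ∑ c, g (Quotient.mk _ (c, 0)) • LinearMap.proj c
        map_add' := by intro a b; simp [add_smul, Finset.sum_add_distrib]
        map_smul' := by intro a b; simp [Finset.smul_sum, mul_smul] }
    have hQ : LinearMap.ker Psi.dualMap ≤ LinearMap.range Q := by
      intro l hl
      have hl' : ∀ b, l (Psi b) = 0 := fun b => LinearMap.congr_fun (LinearMap.mem_ker.1 hl) b
      have h2 : ∀ d : Dart L.n, l (Pi.single (L.edge d).1 1) = l (Pi.single d.1 1) := by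
        intro d
        obtain ⟨b, hb⟩ := edfun
          (fun x => (if x = d then 1 else 0) + (if x = L.edge d then 1 else 0)) (by
            intro x
            have e1 : L.edge x = d ↔ x = L.edge d :=
              ⟨fun h => by rw [← h, L.edge_edge], fun h => by rw [h, L.edge_edge]⟩
            have e2 : L.edge x = L.edge d ↔ x = d := L.edge.injective.eq_iff
            simp only [e1, e2]
            ring)
        have hs : ∀ (d : Dart L.n) (c : Fin L.n),
            ∑ i, (if (c, i) = d then (1 : K) else 0) = (Pi.single d.1 1 : Fin L.n → K) c := by
          rintro ⟨c', j⟩ c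
          by_cases h : c = c'
          · subst h; simp
          · simp [h]
        have hP : Psi b = Pi.single d.1 1 + Pi.single (L.edge d).1 1 := by
          ext c
          rw [hPsi]
          simp only [hb, Finset.sum_add_distrib, hs, Pi.add_apply]
        have := hl' b
        rw [hP, map_add] at this
        exact (CharTwo.add_eq_zero.1 this).symm
      obtain ⟨g, hg⟩ := comp (fun d => l (Pi.single d.1 1)) (fun d => rfl) h2
      refine ⟨g, ?_⟩
      refine LinearMap.pi_ext' fun c => LinearMap.ext_ring ?_
      change (∑ c, g (Quotient.mk _ (c, 0)) • (LinearMap.proj c : (Fin L.n → K) →ₗ[K] K))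
        (Pi.single c 1) = l (Pi.single c 1)
      simp [hg, Pi.single_apply]
    calc Module.finrank K (LinearMap.ker Psi.dualMap) ≤ Module.finrank K (LinearMap.range Q) :=
          Submodule.finrank_mono hQ
      _ ≤ Module.finrank K (Co → K) := LinearMap.finrank_range_le Q
      _ = Nat.card Co := by rw [Module.finrank_pi, Nat.card_eq_fintype_card]
  have hV : Nat.card Ve ≤ L.n := by
    have : Function.Surjective (fun c : Fin L.n => ve (c, 0)) := by
      intro x
      obtain ⟨⟨c, i⟩, rfl⟩ := Quotient.exists_rep x
      have h : ∀ i : Fin 4, ve (c, i + 1) = ve (c, i) := fun i => ve_eq (c, i)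
      refine ⟨c, ?_⟩
      have h0 := h 0
      have h1 := h 1
      have h2 := h 2
      change ve (c, 0) = ve (c, i)
      fin_cases i
      · rfl
      · exact h0.symm
      · exact (h1.trans h0).symm
      · exact (h2.trans (h1.trans h0)).symm
    simpa using Nat.card_le_card_of_surjective _ this
  have d1 := LinearMap.finrank_range_add_finrank_ker T
  have d2 := LinearMap.finrank_range_add_finrank_ker Psi
  have d3 := LinearMap.finrank_range_add_finrank_ker Psi.dualMap
  rw [LinearMap.finrank_range_dualMap_eq_finrank_range, Subspace.dual_finrank_eq] at d3
  rw [Module.finrank_pi] at d1 d2 d3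
  rw [← Nat.card_eq_fintype_card] at d1 d2
  rw [Fintype.card_fin] at d3
  have eul : (Nat.card Ve : ℤ) - Nat.card Ed + Nat.card Fa = 2 * Nat.card Co := L.planar
  have heq : LinearMap.range T = LinearMap.ker Psi :=
    Submodule.eq_of_le_of_finrank_le hle (by omega)
  have hone : (fun _ => 1 : Ed → K) ∈ LinearMap.ker Psi := by
    rw [LinearMap.mem_ker]
    ext c
    rw [hPsi]
    simp
    rfl
  rw [← heq] at hone
  obtain ⟨g, hg⟩ := hone
  have hgd : ∀ d, g (fa (L.edge d)) = g (fa d) + 1 := by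
    intro d
    have h1 := hT g d
    rw [hg] at h1
    linear_combination -h1 - htwo (g (fa d))
  exact ⟨fun d => g (fa d), hgd, fun d => by simp only [fa_eq, hgd]⟩

theorem smooth_smooth (b : Bool) (i : Fin 4) : smooth b (smooth b i) = i := by
  revert b i; decide

/-- The permutation that runs along the resolution `v`: first along an edge, then through a
crossing. -/
def walk (v : L.State) : Equiv.Perm (Dart L.n) :=
  L.edge.trans
    { toFun := fun d => (d.1, smooth (v d.1) d.2)
      invFun := fun d => (d.1, smooth (v d.1) d.2)
      left_inv := fun d => by simp [smooth_smooth]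
      right_inv := fun d => by simp [smooth_smooth] }

theorem walk_apply (v : L.State) (d : Dart L.n) :
    walk v d = ((L.edge d).1, smooth (v (L.edge d).1) (L.edge d).2) := rfl

theorem circle_walk (v : L.State) (d : Dart L.n) :
    circle v (.inl (walk v d)) = circle v (.inl d) := by
  rw [walk_apply, circle_smoothing, circle_edge]

theorem alternating_smooth {o : Dart L.n → ZMod 2} (ho : ∀ d, o (rotate L.n d) = o d + 1)
    (b : Bool) (c : Fin L.n) (i : Fin 4) : o (c, smooth b i) = o (c, i) + 1 := by
  have h : ∀ i : Fin 4, o (c, i + 1) = o (c, i) + 1 := fun i => ho (c, i)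
  have h0 := h 0
  have h1 := h 1
  have h2 := h 2
  have h3 := h 3
  have e : ∀ x y : ZMod 2, x = y + 1 → y = x + 1 := by decide
  cases b <;> fin_cases i
  · exact h0
  · exact e _ _ h0
  · exact h2
  · exact e _ _ h2
  · exact e _ _ h3
  · exact h1
  · exact e _ _ h1
  · exact h3

theorem sameCycle_walk_iff {o : Dart L.n → ZMod 2} (ho1 : ∀ d, o (L.edge d) = o d + 1)
    (ho2 : ∀ d, o (rotate L.n d) = o d + 1) (v : L.State) {a b : Dart L.n} (hab : o a = o b) :
    (walk v).SameCycle a b ↔ circle v (.inl a) = circle v (.inl b) := by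
  constructor
  · rintro ⟨m, rfl⟩
    have : ∀ m : ℤ, ∀ x, circle v (.inl ((walk v ^ m) x)) = circle v (.inl x) := by
      intro m
      induction m using Int.induction_on with
      | zero => intro x; rfl
      | succ i ih => intro x; rw [zpow_add_one, Equiv.Perm.mul_apply, ih, circle_walk]
      | pred i ih =>
        intro x
        rw [zpow_sub_one, Equiv.Perm.mul_apply, ih, ← circle_walk v ((walk v)⁻¹ x)]; simp
    exact (this m a).symm
  · intro h
    have e : ∀ x y : ZMod 2, x ≠ y → x + 1 = y := by decide
    have e' : ∀ x : ZMod 2, x + 1 ≠ x := by decide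
    let pos : Dart L.n → Dart L.n := fun d => if o d = o a then d else (d.1, smooth (v d.1) d.2)
    let f : L.Point → Option (Quotient (Equiv.Perm.SameCycle.setoid (walk v))) :=
      Sum.elim (fun d => some (Quotient.mk _ (pos d))) (fun _ => none)
    have hw : ∀ d, (Quotient.mk (Equiv.Perm.SameCycle.setoid (walk v)) (walk v d)) =
        Quotient.mk _ d := fun d =>
      Quotient.sound (s := Equiv.Perm.SameCycle.setoid _)
        (Equiv.Perm.SameCycle.symm ⟨1, by simp⟩)
    have hf := eq_of_circle_eq (v := v) f (by
      intro d
      change some _ = some _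
      congr 1
      by_cases hd : o d = o a
      · have h1 : pos d = d := if_pos hd
        have h2 : pos (L.edge d) = walk v d := if_neg (by rw [ho1, hd]; exact e' _)
        rw [h1, h2, hw]
      · have h1 : pos d = walk v (L.edge d) := by rw [walk_apply, L.edge_edge]; exact if_neg hd
        have h2 : pos (L.edge d) = L.edge d := if_pos (by rw [ho1]; exact e _ _ hd)
        rw [h1, h2, hw]) (by
      intro c i
      change some _ = some _
      congr 2
      have hs := alternating_smooth ho2 (v c) c i
      by_cases hd : o (c, i) = o a
      · have h1 : pos (c, i) = (c, i) := if_pos hd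
        have h2 : pos (c, smooth (v c) i) = (c, smooth (v c) (smooth (v c) i)) :=
          if_neg (by rw [hs, hd]; exact e' _)
        rw [h1, h2, smooth_smooth]
      · have h1 : pos (c, i) = (c, smooth (v c) i) := if_neg hd
        have h2 : pos (c, smooth (v c) i) = (c, smooth (v c) i) :=
          if_pos (by rw [hs]; exact e _ _ hd)
        rw [h1, h2]) h
    have h1 : pos a = a := if_pos rfl
    have h2 : pos b = b := if_pos hab.symm
    change some (Quotient.mk _ (pos a)) = some (Quotient.mk _ (pos b)) at hf
    rw [h1, h2, Option.some_inj] at hf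
    exact Quotient.exact hf

/-- Changing the smoothing of a crossing merges or splits circles. -/
theorem split_iff_not (v : L.State) (c : Fin L.n) (hc : v c = false) :
    circle (Function.update v c true) (.inl (c, 0)) =
      circle (Function.update v c true) (.inl (c, 2)) ↔
    ¬ circle v (.inl (c, 0)) = circle v (.inl (c, 2)) := by
  obtain ⟨o, ho1, ho2⟩ := L.exists_alternating
  have e2 : ∀ x : ZMod 2, x + 1 + 1 = x := by decide
  have e' : ∀ x : ZMod 2, x + 1 ≠ x := by decide
  have h1 : o (c, 1) = o (c, 0) + 1 := ho2 (c, 0)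
  have h2 : o (c, 2) = o (c, 0) := by
    have : o (c, 2) = o (c, 1) + 1 := ho2 (c, 1)
    rw [this, h1, e2]
  have h3 : o (c, 3) = o (c, 0) + 1 := by
    have : o (c, 3) = o (c, 2) + 1 := ho2 (c, 2)
    rw [this, h2]
  rw [← sameCycle_walk_iff ho1 ho2 _ h2.symm, ← sameCycle_walk_iff ho1 ho2 _ h2.symm]
  have hpres : ∀ d, o (walk v d) = o d := by
    intro d
    rw [walk_apply, alternating_smooth ho2, Prod.mk.eta, ho1, e2]
  refine sameCycle_swap_iff _ _ {d | o d = o (c, 0)} ?_ rfl (by simp) ?_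
  · intro d hd
    exact (hpres d).trans hd
  · intro d hd
    have hd' : o (L.edge d) = o (c, 0) + 1 := by rw [ho1, hd]
    rw [walk_apply, walk_apply]
    generalize L.edge d = x at hd' ⊢
    obtain ⟨b, i⟩ := x
    by_cases hb : b = c
    · subst hb
      simp only [Function.update_self, hc]
      fin_cases i
      · exact absurd hd'.symm (e' _)
      · exact (Equiv.swap_apply_left _ _).symm
      · exact absurd (h2.symm.trans hd').symm (e' _)
      · exact (Equiv.swap_apply_right _ _).symm
    · simp only [Function.update_of_ne hb]
      rw [Equiv.swap_apply_of_ne_of_ne] <;> simp [hb]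

theorem circle_arcs_false {v : L.State} {c : Fin L.n} (hc : v c = false) :
    circle v (.inl (c, 1)) = circle v (.inl (c, 0)) ∧
    circle v (.inl (c, 3)) = circle v (.inl (c, 2)) := by
  have h0 := circle_smoothing v c 0
  have h2 := circle_smoothing v c 2
  rw [hc] at h0 h2
  exact ⟨h0, h2⟩

theorem circle_arcs_true {v : L.State} {c : Fin L.n} (hc : v c = true) :
    circle v (.inl (c, 3)) = circle v (.inl (c, 0)) ∧
    circle v (.inl (c, 1)) = circle v (.inl (c, 2)) := by
  have h0 := circle_smoothing v c 0
  have h2 := circle_smoothing v c 2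
  rw [hc] at h0 h2
  exact ⟨h0, h2⟩

/-- Each point on a circle through the crossing `c` stays on a circle through `c` after the saddle
at `c`. -/
theorem circle_of_saddle {c : Fin L.n} {v w : L.State}
    (hw : w = Function.update v c true) {r : L.Point} (h : circle v r = circle v (.inl (c, 0))) :
    circle w r = circle w (.inl (c, 0)) ∨ circle w r = circle w (.inl (c, 2)) := by
  classical
  have hwc : w c = true := by simp [hw]
  obtain ⟨a1, a2⟩ := circle_arcs_true hwc
  let W : L.Point → Prop := fun r =>
    circle w r = circle w (.inl (c, 0)) ∨ circle w r = circle w (.inl (c, 2))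
  have hW : ∀ i, W (.inl (c, i)) := by
    intro i
    fin_cases i
    · exact Or.inl rfl
    · exact Or.inr a2
    · exact Or.inr rfl
    · exact Or.inl a1
  have := eq_of_circle_eq (v := v) W (fun d => by simp only [W, circle_edge]) (fun b i => by
    by_cases hb : b = c
    · subst hb
      simp only [hW]
    · have h1 := circle_smoothing w b i
      rw [hw, Function.update_of_ne hb, ← hw] at h1
      simp only [W, h1]) h
  exact cast this.symm (hW 0)

/-- If the four half-edges at `c` lie on one circle of `v`, then changing the smoothing at `c` does
not affect the other circles of `v`. -/
theorem circle_of_away {c : Fin L.n} {v w : L.State} (hvw : ∀ b, b ≠ c → w b = v b)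
    (hv : ∀ i, circle v (.inl (c, i)) = circle v (.inl (c, 0)))
    {r s : L.Point} (h : circle v r = circle v s) (hr : circle v r ≠ circle v (.inl (c, 0))) :
    circle w r = circle w s := by
  classical
  let f : L.Point → Option (Circle w) := fun r =>
    if circle v r = circle v (.inl (c, 0)) then none else some (circle w r)
  have hf : ∀ i, f (.inl (c, i)) = none := fun i => if_pos (hv i)
  have := eq_of_circle_eq (v := v) f (fun d => by simp only [f, circle_edge]) (fun b i => by
    by_cases hb : b = c
    · subst hb
      rw [hf, hf]
    · have h1 := circle_smoothing w b i
      rw [hvw b hb] at h1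
      simp only [f, h1, circle_smoothing]) h
  simpa [f, hr, h ▸ hr] using this

theorem circle_eq_of_split {c : Fin L.n} {v : L.State} (hc : v c = false)
    (hs : circle v (.inl (c, 0)) = circle v (.inl (c, 2))) (i : Fin 4) :
    circle v (.inl (c, i)) = circle v (.inl (c, 0)) := by
  obtain ⟨a1, a2⟩ := circle_arcs_false hc
  fin_cases i
  · rfl
  · exact a1
  · exact hs.symm
  · exact a2.trans hs.symm

theorem circle_eq_of_merge {c : Fin L.n} {v w : L.State} (hc : v c = false)
    (hw : w = Function.update v c true) (hm : circle v (.inl (c, 0)) ≠ circle v (.inl (c, 2)))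
    (i : Fin 4) : circle w (.inl (c, i)) = circle w (.inl (c, 0)) := by
  have hwc : w c = true := by simp [hw]
  obtain ⟨a1, a2⟩ := circle_arcs_true hwc
  have h02 : circle w (.inl (c, 0)) = circle w (.inl (c, 2)) := by
    rw [hw]; exact (split_iff_not v c hc).2 hm
  fin_cases i
  · rfl
  · exact a2.trans h02.symm
  · exact h02.symm
  · exact a1

/-- A merging saddle joins circles. -/
theorem circle_of_merge {c : Fin L.n} {v w : L.State} (hc : v c = false)
    (hw : w = Function.update v c true) (hm : circle v (.inl (c, 0)) ≠ circle v (.inl (c, 2)))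
    {r s : L.Point} (h : circle v r = circle v s) : circle w r = circle w s := by
  have hf := circle_eq_of_merge hc hw hm
  refine eq_of_circle_eq (v := v) (circle w) (fun d => circle_edge w d) (fun b i => ?_) h
  by_cases hb : b = c
  · subst hb
    rw [hf, hf i]
  · have h1 := circle_smoothing w b i
    rwa [hw, Function.update_of_ne hb, ← hw] at h1

/-- A splitting saddle refines the partition into circles. -/
theorem circle_of_split_refine {c : Fin L.n} {v w : L.State} (hc : v c = false)
    (hw : w = Function.update v c true) (hs : circle v (.inl (c, 0)) = circle v (.inl (c, 2)))
    {r s : L.Point} (h : circle w r = circle w s) : circle v r = circle v s := by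
  have hf := circle_eq_of_split hc hs
  refine eq_of_circle_eq (v := w) (circle v) (fun d => circle_edge v d) (fun b i => ?_) h
  by_cases hb : b = c
  · subst hb
    rw [hf, hf i]
  · rw [hw, Function.update_of_ne hb, circle_smoothing]

theorem atPoint_eq {v : L.State} {r s : L.Point} (h : circle v r = circle v s) :
    atPoint v r = atPoint v s := by
  rw [atPoint, h, atPoint]

theorem saddle_tprod (c : Fin L.n) (v w : L.State) (y : Circle v → AlphaAlg) :
    saddle c v w (PiTensorProduct.tprod AlphaRing y) =
      ∏ C, (if circle v (.inl (c, 0)) = circle v (.inl (c, 2)) ∧ C = circle v (.inl (c, 0))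
        then (Algebra.TensorProduct.productMap (atPoint w (.inl (c, 0)))
          (atPoint w (.inl (c, 2)))).toLinearMap ∘ₗ comul
        else (atPoint w C.out).toLinearMap) (y C) := by
  rw [saddle, PiTensorProduct.lift.tprod]
  rfl

/-- Saddle maps commute with the action of the algebra at any point of the diagram. -/
theorem saddle_atPoint_mul {c : Fin L.n} {v w : L.State} (hc : v c = false)
    (hw : w = Function.update v c true) (r : L.Point) (a : AlphaAlg) (y : Chains v) :
    saddle c v w (atPoint v r a * y) = atPoint w r a * saddle c v w y := by
  induction y using PiTensorProduct.induction_on with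
  | add x y hx hy => rw [mul_add, map_add, map_add, mul_add, hx, hy]
  | smul_tprod t y =>
    rw [mul_smul_comm, map_smul, map_smul, mul_smul_comm]
    congr 1
    have h1 : atPoint v r a * PiTensorProduct.tprod AlphaRing y =
        PiTensorProduct.tprod AlphaRing (Pi.mulSingle (circle v r) a * y) := by
      rw [atPoint, PiTensorProduct.singleAlgHom_apply, PiTensorProduct.tprod_mul_tprod]
      rfl
    rw [h1, saddle_tprod, saddle_tprod]
    have h2 : atPoint w r a = ∏ C, (Pi.mulSingle (circle v r) (atPoint w r a) : Circle v → _) C := by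
      rw [Fintype.prod_eq_single (circle v r) (fun C hC => Pi.mulSingle_eq_of_ne hC _),
        Pi.mulSingle_eq_same]
    rw [h2, ← Finset.prod_mul_distrib]
    refine Finset.prod_congr rfl fun C _ => ?_
    by_cases hC : C = circle v r
    · subst hC
      rw [Pi.mul_apply, Pi.mulSingle_eq_same, Pi.mulSingle_eq_same]
      split_ifs with hs
      · simp only [LinearMap.comp_apply, AlgHom.toLinearMap_apply]
        rcases circle_of_saddle hw hs.2 with h | h
        · rw [comul_mul_left, map_mul, atPoint_eq h]
          simp
        · rw [comul_mul_right, map_mul, atPoint_eq h]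
          simp
      · simp only [AlgHom.toLinearMap_apply, map_mul]
        congr 2
        refine atPoint_eq ?_
        have ho : circle v (circle v r).out = circle v r := Quotient.out_eq _
        by_cases h02 : circle v (.inl (c, 0)) = circle v (.inl (c, 2))
        · exact circle_of_away (fun b hb => by rw [hw, Function.update_of_ne hb])
            (circle_eq_of_split hc h02) ho (by rw [ho]; exact fun h => hs ⟨h02, h⟩)
        · exact circle_of_merge hc hw h02 ho
    · rw [Pi.mul_apply, Pi.mulSingle_eq_of_ne hC, Pi.mulSingle_eq_of_ne hC, one_mul, one_mul]

theorem saddle_one_of_merge {c : Fin L.n} {v w : L.State}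
    (hm : circle v (.inl (c, 0)) ≠ circle v (.inl (c, 2))) : saddle c v w 1 = 1 := by
  rw [PiTensorProduct.one_def, saddle_tprod]
  refine Finset.prod_eq_one fun C _ => ?_
  rw [if_neg (fun h => hm h.1)]
  simp

theorem saddle_one_of_split {c : Fin L.n} {v w : L.State}
    (hs : circle v (.inl (c, 0)) = circle v (.inl (c, 2))) :
    saddle c v w 1 = atPoint w (.inl (c, 0)) (digit 0) + atPoint w (.inl (c, 2)) (digit 1) := by
  rw [PiTensorProduct.one_def, saddle_tprod,
    Finset.prod_eq_single (circle v (.inl (c, 0))) (fun C _ hC => by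
      rw [if_neg (fun h => hC h.2)]; simp) (by simp)]
  rw [if_pos ⟨hs, rfl⟩]
  simp only [LinearMap.comp_apply, AlgHom.toLinearMap_apply, Pi.one_apply, comul_one, comulOne]
  simp

/-- The two orders of the summands of `Δ(1)` agree. -/
theorem atPoint_digit_comm (w : L.State) (p q : L.Point) :
    atPoint w p (digit 0) + atPoint w q (digit 1) =
      atPoint w q (digit 0) + atPoint w p (digit 1) := by
  have h : digit 0 = digit 1 +
      algebraMap AlphaRing AlphaAlg (MvPolynomial.X 1 - MvPolynomial.X 0) := by
    rw [← digit_zero_sub_one]; ring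
  rw [h, map_add, map_add, AlgHom.commutes, AlgHom.commutes]
  ring

theorem linearMap_ext_of_atPoint {v w : L.State} {F G : Chains v →ₗ[AlphaRing] Chains w}
    (hF : ∀ r a y, F (atPoint v r a * y) = atPoint w r a * F y)
    (hG : ∀ r a y, G (atPoint v r a * y) = atPoint w r a * G y) (h1 : F 1 = G 1) : F = G := by
  refine PiTensorProduct.ext (MultilinearMap.ext fun y => ?_)
  have key : ∀ s : Finset (Circle v),
      F (∏ C ∈ s, atPoint v C.out (y C)) = G (∏ C ∈ s, atPoint v C.out (y C)) := by
    intro s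
    induction s using Finset.induction_on with
    | empty => simpa using h1
    | insert C s hC ih => rw [Finset.prod_insert hC, hF, hG, ih]
  have hy : PiTensorProduct.tprod AlphaRing y = ∏ C, atPoint v C.out (y C) := by
    have h2 : ∀ C : Circle v, atPoint v C.out (y C) =
        PiTensorProduct.tprod AlphaRing (Pi.mulSingle C (y C)) := by
      intro C
      have : circle v C.out = C := Quotient.out_eq _
      rw [atPoint, this]
      rfl
    simp only [h2, ← PiTensorProduct.tprod_prod]
    rw [Finset.univ_prod_mulSingle]
  simp only [LinearMap.compMultilinearMap_apply]
  rw [hy, key]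

/-- The faces of the cube of resolutions commute. -/
theorem saddle_comm {c b : Fin L.n} (hcb : c ≠ b) {v u u' w : L.State} (hc : v c = false)
    (hb : v b = false) (hu : u = Function.update v c true) (hu' : u' = Function.update v b true)
    (hw : w = Function.update u b true) (hw' : w = Function.update u' c true) :
    saddle b u w ∘ₗ saddle c v u = saddle c u' w ∘ₗ saddle b v u' := by
  have hub : u b = false := by rw [hu, Function.update_of_ne hcb.symm, hb]
  have huc : u' c = false := by rw [hu', Function.update_of_ne hcb, hc]
  refine linearMap_ext_of_atPoint
    (fun r a y => by
      simp only [LinearMap.comp_apply]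
      rw [saddle_atPoint_mul hc hu, saddle_atPoint_mul hub hw])
    (fun r a y => by
      simp only [LinearMap.comp_apply]
      rw [saddle_atPoint_mul hb hu', saddle_atPoint_mul huc hw']) ?_
  simp only [LinearMap.comp_apply]
  have K1 := split_iff_not v c hc
  have K2 := split_iff_not u b hub
  have K3 := split_iff_not v b hb
  have K4 := split_iff_not u' c huc
  rw [← hu] at K1
  rw [← hw] at K2
  rw [← hu'] at K3
  rw [← hw'] at K4
  have digits : ∀ {x y : L.State} {e : Fin L.n} {p q : L.Point}, x e = false →
      y = Function.update x e true →
      saddle e x y (atPoint x p (digit 0) + atPoint x q (digit 1)) =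
        (atPoint y p (digit 0) + atPoint y q (digit 1)) * saddle e x y 1 := by
    intro x y e p q he hy
    have e1 := saddle_atPoint_mul he hy p (digit 0) 1
    have e2 := saddle_atPoint_mul he hy q (digit 1) 1
    rw [mul_one] at e1 e2
    rw [map_add, e1, e2, add_mul]
  by_cases s1 : circle v (.inl (c, 0)) = circle v (.inl (c, 2))
  · by_cases s2 : circle u (.inl (b, 0)) = circle u (.inl (b, 2))
    · have t1 := circle_of_split_refine hc hu s1 s2
      have t2 : circle u' (.inl (c, 0)) = circle u' (.inl (c, 2)) := by
        by_contra h
        exact K1.1 (circle_of_split_refine hub hw s2 (K4.2 h)) s1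
      rw [saddle_one_of_split s1, saddle_one_of_split t1, digits hub hw, digits huc hw',
        saddle_one_of_split s2, saddle_one_of_split t2, mul_comm]
    · by_cases t1 : circle v (.inl (b, 0)) = circle v (.inl (b, 2))
      · have t2 : circle u' (.inl (c, 0)) ≠ circle u' (.inl (c, 2)) := by
          intro h
          exact K3.1 (circle_of_split_refine huc hw' h (K2.2 s2)) t1
        rw [saddle_one_of_split s1, saddle_one_of_split t1, digits hub hw, digits huc hw',
          saddle_one_of_merge s2, saddle_one_of_merge t2, mul_one, mul_one]
        have hbc : circle v (.inl (b, 0)) = circle v (.inl (c, 0)) := by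
          by_contra h
          exact s2 (circle_of_away (fun e he => by rw [hu, Function.update_of_ne he])
            (circle_eq_of_split hc s1) t1 h)
        have x1 : circle w (.inl (b, 0)) = circle w (.inl (c, 0)) ∨
            circle w (.inl (b, 0)) = circle w (.inl (c, 2)) :=
          (circle_of_saddle hu hbc).imp (circle_of_merge hub hw s2) (circle_of_merge hub hw s2)
        have x2 := K2.2 s2
        have x3 := K4.2 t2
        rw [atPoint_eq x2.symm, atPoint_eq x3.symm]
        rcases x1 with x1 | x1
        · rw [atPoint_eq x1]
        · rw [atPoint_eq (x1.trans x3.symm)]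
      · have t2 : circle u' (.inl (c, 0)) = circle u' (.inl (c, 2)) :=
          circle_of_merge hb hu' t1 s1
        rw [saddle_one_of_split s1, saddle_one_of_merge t1, digits hub hw,
          saddle_one_of_merge s2, saddle_one_of_split t2, mul_one]
  · by_cases s2 : circle u (.inl (b, 0)) = circle u (.inl (b, 2))
    · rw [saddle_one_of_merge s1, saddle_one_of_split s2]
      by_cases t1 : circle v (.inl (b, 0)) = circle v (.inl (b, 2))
      · have t2 : circle u' (.inl (c, 0)) ≠ circle u' (.inl (c, 2)) := fun h =>
          s1 (circle_of_split_refine hb hu' t1 h)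
        rw [saddle_one_of_split t1, digits huc hw', saddle_one_of_merge t2, mul_one]
      · have t2 : circle u' (.inl (c, 0)) = circle u' (.inl (c, 2)) := by
          by_contra h
          exact K2.1 (circle_of_merge huc hw' h (K3.2 t1)) s2
        rw [saddle_one_of_merge t1, saddle_one_of_split t2]
        have hbc : circle u (.inl (b, 0)) = circle u (.inl (c, 0)) := by
          by_contra h
          exact t1 (circle_of_away (fun e he => by rw [hu, Function.update_of_ne he])
            (circle_eq_of_merge hc hu s1) s2 h)
        have y0 := circle_of_saddle hw hbc.symm
        have y2 := circle_of_saddle hw ((K1.2 s1).symm.trans hbc.symm)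
        have y02 : circle w (.inl (c, 0)) ≠ circle w (.inl (c, 2)) := fun h => K4.1 h t2
        rcases y0 with y0 | y0 <;> rcases y2 with y2 | y2
        · exact absurd (y0.trans y2.symm) y02
        · rw [atPoint_eq y0, atPoint_eq y2]
        · rw [atPoint_eq y0, atPoint_eq y2, atPoint_digit_comm]
        · exact absurd (y0.trans y2.symm) y02
    · have t1 : circle v (.inl (b, 0)) ≠ circle v (.inl (b, 2)) := fun h =>
        s2 (circle_of_merge hc hu s1 h)
      have t2 : circle u' (.inl (c, 0)) ≠ circle u' (.inl (c, 2)) := fun h =>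
        K4.1 (circle_of_merge hub hw s2 (K1.2 s1)) h
      rw [saddle_one_of_merge s1, saddle_one_of_merge t1, saddle_one_of_merge s2,
        saddle_one_of_merge t2]

/-! ### The complex -/

theorem edgeSign_mul {c b : Fin L.n} (hcb : c ≠ b) {v : L.State} (hc : v c = false)
    (hb : v b = false) :
    edgeSign v c * edgeSign (Function.update v c true) b =
      -(edgeSign v b * edgeSign (Function.update v b true) c) := by
  have key : ∀ {c b : Fin L.n}, v c = false → c < b →
      edgeSign (Function.update v c true) b = - edgeSign v b ∧
      edgeSign (Function.update v b true) c = edgeSign v c := by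
    intro c b hc h
    constructor
    · have : (Finset.univ.filter fun a => a < b ∧ Function.update v c true a = true) =
          insert c (Finset.univ.filter fun a => a < b ∧ v a = true) := by
        ext a
        by_cases ha : a = c
        · subst ha; simp [h]
        · simp [ha]
      rw [edgeSign, edgeSign, this, Finset.card_insert_of_notMem (by simp [hc]), pow_succ]
      ring
    · have : (Finset.univ.filter fun a => a < c ∧ Function.update v b true a = true) =
          (Finset.univ.filter fun a => a < c ∧ v a = true) := by
        ext a
        by_cases ha : a = b
        · subst ha; simp [h.le]
        · simp [ha]
      rw [edgeSign, edgeSign, this]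
  rcases lt_or_gt_of_ne hcb with h | h
  · obtain ⟨h1, h2⟩ := key hc h
    rw [h1, h2]; ring
  · obtain ⟨h1, h2⟩ := key hb h
    rw [h1, h2]; ring

theorem component_comp (v w : L.State) : ∑ u, component u w ∘ₗ component v u = 0 := by
  let g : Fin L.n × Fin L.n → (Chains v →ₗ[AlphaRing] Chains w) := fun x =>
    if v x.1 = false ∧ v x.2 = false ∧ x.1 ≠ x.2 ∧
        w = Function.update (Function.update v x.1 true) x.2 true then
      (edgeSign v x.1 * edgeSign (Function.update v x.1 true) x.2) •
        (saddle x.2 (Function.update v x.1 true) w ∘ₗ saddle x.1 v (Function.update v x.1 true))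
    else 0
  have h1 : ∑ u, component u w ∘ₗ component v u = ∑ x, g x := by
    rw [Fintype.sum_prod_type]
    have : ∀ u, component u w ∘ₗ component v u = ∑ c, ∑ b,
        if u = Function.update v c true then g (c, b) else 0 := by
      intro u
      have hsum : component u w ∘ₗ component v u = ∑ c, ∑ b,
          (if u b = false ∧ w = Function.update u b true then edgeSign u b • saddle b u w else 0) ∘ₗ
          (if v c = false ∧ u = Function.update v c true then edgeSign v c • saddle c v u else 0) := by
        refine LinearMap.ext fun y => ?_
        simp only [component, LinearMap.comp_apply, LinearMap.sum_apply, map_sum]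
      rw [hsum]
      refine Finset.sum_congr rfl fun c _ => Finset.sum_congr rfl fun b _ => ?_
      by_cases hu : u = Function.update v c true
      · subst hu
        rw [if_pos rfl]
        by_cases hc : v c = false
        · by_cases hcb : c = b
          · subst hcb; simp [g]
          · simp only [g, hc, hcb, Function.update_of_ne (Ne.symm hcb), true_and, ne_eq,
              not_false_eq_true, and_self, if_true]
            split_ifs
            · rw [LinearMap.smul_comp, LinearMap.comp_smul, smul_smul,
                mul_comm (edgeSign v c)]
            · rw [LinearMap.zero_comp]
        · simp [g, hc]
      · simp [hu]
    simp only [this]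
    rw [Finset.sum_comm]
    refine Finset.sum_congr rfl fun c _ => ?_
    rw [Finset.sum_comm]
    refine Finset.sum_congr rfl fun b _ => ?_
    rw [Finset.sum_ite_eq']
    simp
  rw [h1]
  refine Finset.sum_involution (fun x _ => x.swap) ?_ ?_ (fun _ _ => Finset.mem_univ _)
    (fun x _ => x.swap_swap)
  · rintro ⟨c, b⟩ -
    by_cases h : v c = false ∧ v b = false ∧ c ≠ b ∧
        w = Function.update (Function.update v c true) b true
    · obtain ⟨hc, hb, hcb, hw⟩ := h
      have hw' : w = Function.update (Function.update v b true) c true := by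
        rw [hw, Function.update_comm hcb]
      have e1 : g (c, b) = _ := if_pos ⟨hc, hb, hcb, hw⟩
      have e2 : g (b, c) = _ := if_pos ⟨hb, hc, hcb.symm, hw'⟩
      rw [Prod.swap_prod_mk, e1, e2]
      simp only
      rw [saddle_comm hcb hc hb rfl rfl hw hw', edgeSign_mul hcb hc hb, ← add_smul,
        neg_add_cancel, zero_smul]
    · have h' : ¬ (v b = false ∧ v c = false ∧ b ≠ c ∧
          w = Function.update (Function.update v b true) c true) := by
        rintro ⟨hb, hc, hcb, hw⟩
        exact h ⟨hc, hb, hcb.symm, by rw [hw, Function.update_comm hcb]⟩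
      have e1 : g (c, b) = 0 := if_neg h
      have e2 : g (b, c) = 0 := if_neg h'
      rw [Prod.swap_prod_mk, e1, e2, add_zero]
  · rintro ⟨c, b⟩ - h hs
    refine h (if_neg ?_)
    rintro ⟨-, -, hcb, -⟩
    exact hcb (congrArg Prod.snd hs)

theorem degree_update {v : L.State} {c : Fin L.n} (hc : v c = false) :
    degree (Function.update v c true) = degree v + 1 := by
  have : (Finset.univ.filter fun a => Function.update v c true a = true) =
      insert c (Finset.univ.filter fun a => v a = true) := by
    ext a
    by_cases ha : a = c
    · subst ha; simp
    · simp [ha]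
  rw [degree, degree, this, Finset.card_insert_of_notMem (by simp [hc])]
  push_cast
  ring

theorem component_eq_zero {v w : L.State} (h : degree v + 1 ≠ degree w) : component v w = 0 := by
  refine Finset.sum_eq_zero fun c _ => if_neg ?_
  rintro ⟨hc, rfl⟩
  exact h (degree_update hc).symm

/-- The degree `i` part of the complex. -/
abbrev ChainsIn (L : LinkDiagram) (i : ℤ) : Type :=
  (v : {v : L.State // degree v = i}) → Chains v.1

/-- The differential. -/
noncomputable def differential (L : LinkDiagram) (i j : ℤ) :
    L.ChainsIn i →ₗ[AlphaRing] L.ChainsIn j :=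
  LinearMap.pi fun w => ∑ v : {v : L.State // degree v = i}, component v.1 w.1 ∘ₗ LinearMap.proj v

theorem differential_apply (i j : ℤ) (x : L.ChainsIn i) (w : {w : L.State // degree w = j}) :
    L.differential i j x w = ∑ v : {v : L.State // degree v = i}, component v.1 w.1 (x v) := by
  simp [differential]

theorem differential_eq_zero {i j : ℤ} (h : i + 1 ≠ j) : L.differential i j = 0 := by
  refine LinearMap.ext fun x => funext fun w => ?_
  rw [differential_apply]
  refine Finset.sum_eq_zero fun v _ => ?_
  rw [component_eq_zero (by rw [v.2, w.2]; exact h)]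
  rfl

theorem differential_comp (i j k : ℤ) (hij : i + 1 = j) :
    L.differential j k ∘ₗ L.differential i j = 0 := by
  refine LinearMap.ext fun x => funext fun w => ?_
  rw [LinearMap.comp_apply, differential_apply]
  simp only [differential_apply, map_sum]
  rw [Finset.sum_comm]
  refine Finset.sum_eq_zero fun v _ => ?_
  have h := LinearMap.congr_fun (component_comp v.1 w.1) (x v)
  rw [LinearMap.sum_apply] at h
  refine Eq.trans ?_ h
  rw [← Finset.sum_filter_add_sum_filter_not Finset.univ (fun u : L.State => degree u = j),
    Finset.sum_eq_zero (s := Finset.univ.filter fun u : L.State => ¬ degree u = j), add_zero]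
  · exact (Finset.sum_subtype _ (by simp)
      fun u => (component u w.1 ∘ₗ component v.1 u) (x v)).symm
  · intro u hu
    rw [Finset.mem_filter] at hu
    rw [component_eq_zero (v := v.1) (w := u)
      (by rw [v.2, hij]; exact fun h => hu.2 h.symm), LinearMap.comp_zero]
    rfl

/-- The cochain complex over `ℤ[α₁, α₂]` of the diagram. -/
noncomputable def alphaComplex (L : LinkDiagram) : CochainComplex (ModuleCat AlphaRing) ℤ where
  X i := ModuleCat.of AlphaRing (L.ChainsIn i)
  d i j := ModuleCat.ofHom (L.differential i j)
  shape i j h := by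
    rw [differential_eq_zero (by simpa using h)]
    rfl
  d_comp_d' i j k hij _ := by
    rw [← ModuleCat.ofHom_comp, differential_comp i j k (by simpa using hij)]
    rfl

theorem component_atPoint_mul (v w : L.State) (p : L.Point) (a : AlphaAlg) (y : Chains v) :
    component v w (atPoint v p a * y) = atPoint w p a * component v w y := by
  simp only [component, LinearMap.sum_apply, Finset.mul_sum]
  refine Finset.sum_congr rfl fun c _ => ?_
  split_ifs with h
  · rw [LinearMap.smul_apply, LinearMap.smul_apply, saddle_atPoint_mul h.1 h.2, mul_smul_comm]
  · simp

theorem differential_atPoint_mul (i j : ℤ) (p : L.Point) (a : AlphaAlg) (x : L.ChainsIn i)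
    (w : {w : L.State // degree w = j}) :
    L.differential i j (fun v => atPoint v.1 p a * x v) w =
      atPoint w.1 p a * L.differential i j x w := by
  rw [differential_apply, differential_apply, Finset.mul_sum]
  exact Finset.sum_congr rfl fun v _ => component_atPoint_mul _ _ _ _ _

/-- The chain map given by placing the element `a` (for instance a digit) at the point `p`: on every
resolution, multiplication by `a` in the tensor factor of the circle through `p`. -/
noncomputable def placeAt (L : LinkDiagram) (a : AlphaAlg) (p : L.Point) :
    L.alphaComplex ⟶ L.alphaComplex where
  f i := ModuleCat.ofHom
    (LinearMap.pi fun v => LinearMap.mulLeft AlphaRing (atPoint v.1 p a) ∘ₗ LinearMap.proj v)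
  comm' i j _ := by
    refine ModuleCat.hom_ext (LinearMap.ext fun x => funext fun w => ?_)
    exact differential_atPoint_mul i j p a x w

/-- The endomorphism of the degree `i` part of the homology that is induced by placing a digit at the
point `p`. -/
noncomputable def digitMap (L : LinkDiagram) (j : Fin 2) (p : L.Point) (i : ℤ) :
    L.alphaComplex.homology i ⟶ L.alphaComplex.homology i :=
  HomologicalComplex.homologyMap (L.placeAt (digit j) p) i

/-- The point `p` lies on the edge of the diagram that leaves the crossing along the half-edge
`d`. -/
def OnEdge (p : L.Point) (d : Dart L.n) : Prop := p = .inl d ∨ p = .inl (L.edge d)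

/-- The points `p` and `q` lie on either side of the crossing `c`: on the two edges that are opposite
to each other at `c`, so that the strand from `p` to `q` passes `c` and no other crossing. -/
def OnEitherSide (c : Fin L.n) (p q : L.Point) : Prop :=
  ∃ i : Fin 4, OnEdge p (c, i) ∧ OnEdge q (c, i + 2)

end LinkDiagram

/-! The sum of the two digits is null-homotopic, and the homotopy is the reverse saddle at `c`: on
every resolution with a `1`-smoothing at `c`, undo that smoothing and keep the sign of the cube
edge. The definition of `saddle` looks only at the circles of its source and target, never at the
direction of the change, so the same maps serve in both directions. The half-edges `0` and `2` lie
on different arcs at `c` in both smoothings. By planarity (`split_iff_not`), each change of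
smoothing either merges two circles or splits one, so the reverse of a split is a merge and
conversely.

The commutator of the homotopy with the differential is computed by matrix entries. On the diagonal
it is a saddle followed by its reverse. Both orders, `m` after `Δ` and `Δ` after `m`, give
multiplication by `Δ(1)` with its tensor factors placed on the two arcs at `c`
(`Flip.saddle_comp_saddle`). Off the diagonal, the reverse saddle at `c` meets a saddle at another
crossing. The two commute as maps (`Flip.saddle_comm`), and the signs around a face of the cube make
the two composites cancel (`backComponent_anticomm`).

It remains to recognise `Δ(1) = (X - α₁) ⊗ 1 + 1 ⊗ (X - α₂)` as the sum of the digits at `p` and `q`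
(`OnEitherSide.digits_eq`). Opposite half-edges at `c` always belong to different arcs. Which point
lies on which arc depends on the resolution, but this is harmless because `Δ(1)` is symmetric.

All identities between saddles are checked on the unit only: saddles are linear over the action of
the algebra at every point, and these actions generate the chains from `1`
(`linearMap_ext_of_atPoint`). -/

namespace LinkDiagram

variable {L : LinkDiagram}

/-! ### Circles under a change of one smoothing in either direction -/

/-- The resolution `w` differs from `v` at the crossing `c` and nowhere else. In contrast to the
edges of the cube, the change may go in either direction. -/
def Flip (c : Fin L.n) (v w : L.State) : Prop := w c = !v c ∧ ∀ b, b ≠ c → w b = v b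

theorem Flip.symm {c : Fin L.n} {v w : L.State} (h : Flip c v w) : Flip c w v :=
  ⟨by rw [h.1, Bool.not_not], fun b hb => (h.2 b hb).symm⟩

theorem flip_update (c : Fin L.n) {v : L.State} {x : Bool} (hc : v c = !x) :
    Flip c v (Function.update v c x) :=
  ⟨by simp [hc], fun _ hb => Function.update_of_ne hb _ _⟩

theorem Flip.eq_update {c : Fin L.n} {v w : L.State} (h : Flip c v w) :
    w = Function.update v c (!v c) := by
  funext b
  by_cases hb : b = c
  · subst hb; simp [h.1]
  · rw [Function.update_of_ne hb, h.2 b hb]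

/-- Every half-edge at `c` lies on one of the two arcs at `c`, which end in `0` and `2`. -/
theorem circle_crossing (v : L.State) (c : Fin L.n) (i : Fin 4) :
    circle v (.inl (c, i)) = circle v (.inl (c, 0)) ∨
      circle v (.inl (c, i)) = circle v (.inl (c, 2)) := by
  cases hc : v c
  · obtain ⟨a1, a2⟩ := circle_arcs_false hc
    fin_cases i
    · exact Or.inl rfl
    · exact Or.inl a1
    · exact Or.inr rfl
    · exact Or.inr a2
  · obtain ⟨a1, a2⟩ := circle_arcs_true hc
    fin_cases i
    · exact Or.inl rfl
    · exact Or.inr a2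
    · exact Or.inr rfl
    · exact Or.inl a1

theorem circle_crossing_eq {v : L.State} {c : Fin L.n}
    (h : circle v (.inl (c, 0)) = circle v (.inl (c, 2))) (i : Fin 4) :
    circle v (.inl (c, i)) = circle v (.inl (c, 0)) :=
  (circle_crossing v c i).elim id fun h' => h'.trans h.symm

/-- Changing the smoothing of a crossing in either direction merges or splits circles. -/
theorem Flip.split_iff_not {c : Fin L.n} {v w : L.State} (h : Flip c v w) :
    circle w (.inl (c, 0)) = circle w (.inl (c, 2)) ↔
      ¬ circle v (.inl (c, 0)) = circle v (.inl (c, 2)) := by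
  cases hc : v c
  · have hw := h.eq_update
    rw [hc] at hw
    rw [hw]
    exact LinkDiagram.split_iff_not v c hc
  · have hv := h.symm.eq_update
    have hwc : w c = false := by rw [h.1, hc]; rfl
    rw [hwc] at hv
    have := LinkDiagram.split_iff_not w c hwc
    rw [Bool.not_false] at hv
    rw [← hv] at this
    rw [this, not_not]

/-- Away from `c` the two resolutions have the same connections, and at `c` all four half-edges lie
on a single circle of `w`, so every connection of `v` is respected by the circles of `w`. Applied to
`h` it says that a merge coarsens the partition into circles; applied to `h.symm`, that a split
refines it. -/
theorem Flip.circle_mono {c : Fin L.n} {v w : L.State} (h : Flip c v w)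
    (hw : circle w (.inl (c, 0)) = circle w (.inl (c, 2))) {r s : L.Point}
    (hrs : circle v r = circle v s) : circle w r = circle w s := by
  have hf := circle_crossing_eq hw
  refine eq_of_circle_eq (v := v) (circle w) (fun d => circle_edge w d) (fun b i => ?_) hrs
  by_cases hb : b = c
  · subst hb
    rw [hf, hf i]
  · rw [← h.2 b hb, circle_smoothing]

/-- Lying on a circle of `w` through `c` is a property that holds at all four half-edges of `c` and
is preserved by the connections elsewhere, which `v` and `w` share. Hence it is constant along
circles of `v`. -/
theorem Flip.circle_eq_or {c : Fin L.n} {v w : L.State} (h : Flip c v w) {r : L.Point}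
    (hr : circle v r = circle v (.inl (c, 0))) :
    circle w r = circle w (.inl (c, 0)) ∨ circle w r = circle w (.inl (c, 2)) := by
  let W : L.Point → Prop := fun r =>
    circle w r = circle w (.inl (c, 0)) ∨ circle w r = circle w (.inl (c, 2))
  have hW : ∀ i, W (.inl (c, i)) := circle_crossing w c
  have := eq_of_circle_eq (v := v) W (fun d => by simp only [W, circle_edge]) (fun b i => by
    by_cases hb : b = c
    · subst hb
      simp only [hW]
    · have h1 := circle_smoothing w b i
      rw [h.2 b hb] at h1
      simp only [W, h1]) hr
  exact cast this.symm (hW 0)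

/-! ### Linearity, composition and commutation of saddles -/

/-- Saddle maps in either direction are linear over the action of the algebra at any point. -/
theorem Flip.saddle_atPoint_mul {c : Fin L.n} {v w : L.State} (h : Flip c v w) (r : L.Point)
    (a : AlphaAlg) (y : Chains v) :
    saddle c v w (atPoint v r a * y) = atPoint w r a * saddle c v w y := by
  induction y using PiTensorProduct.induction_on with
  | add x y hx hy => rw [mul_add, map_add, map_add, mul_add, hx, hy]
  | smul_tprod t y =>
    rw [mul_smul_comm, map_smul, map_smul, mul_smul_comm]
    congr 1
    have h1 : atPoint v r a * PiTensorProduct.tprod AlphaRing y =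
        PiTensorProduct.tprod AlphaRing (Pi.mulSingle (circle v r) a * y) := by
      rw [atPoint, PiTensorProduct.singleAlgHom_apply, PiTensorProduct.tprod_mul_tprod]
      rfl
    rw [h1, saddle_tprod, saddle_tprod]
    -- Spreading `a` as a product over the circles, trivial except at the circle of `r`, lets the
    -- two sides be compared factor by factor.
    have h2 : atPoint w r a = ∏ C, (Pi.mulSingle (circle v r) (atPoint w r a) : Circle v → _) C := by
      rw [Fintype.prod_eq_single (circle v r) (fun C hC => Pi.mulSingle_eq_of_ne hC _),
        Pi.mulSingle_eq_same]
    rw [h2, ← Finset.prod_mul_distrib]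
    refine Finset.prod_congr rfl fun C _ => ?_
    by_cases hC : C = circle v r
    · subst hC
      rw [Pi.mul_apply, Pi.mulSingle_eq_same, Pi.mulSingle_eq_same]
      split_ifs with hs
      · simp only [LinearMap.comp_apply, AlgHom.toLinearMap_apply]
        -- The circle of `r` is the one that splits. Afterwards `r` lies on one of the two new
        -- circles, and `Δ` is linear over either tensor factor.
        rcases h.circle_eq_or hs.2 with h | h
        · rw [comul_mul_left, map_mul, atPoint_eq h]
          simp
        · rw [comul_mul_right, map_mul, atPoint_eq h]
          simp
      · simp only [AlgHom.toLinearMap_apply, map_mul]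
        congr 2
        refine atPoint_eq ?_
        -- The saddle carries this factor along the chosen representative of the circle, so `r` and
        -- the representative must stay together in `w`. In a split their circle is away from `c`;
        -- in a merge circles only grow.
        have ho : circle v (circle v r).out = circle v r := Quotient.out_eq _
        by_cases h02 : circle v (.inl (c, 0)) = circle v (.inl (c, 2))
        · exact circle_of_away h.2 (circle_crossing_eq h02) ho
            (by rw [ho]; exact fun h => hs ⟨h02, h⟩)
        · exact h.circle_mono (h.split_iff_not.2 h02) ho
    · rw [Pi.mul_apply, Pi.mulSingle_eq_of_ne hC, Pi.mulSingle_eq_of_ne hC, one_mul, one_mul]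

/-- This evaluates a saddle on the element `Δ(1)` that an earlier split has produced from the unit.
-/
theorem Flip.saddle_digits {c : Fin L.n} {v w : L.State} (h : Flip c v w) (p q : L.Point) :
    saddle c v w (atPoint v p (digit 0) + atPoint v q (digit 1)) =
      (atPoint w p (digit 0) + atPoint w q (digit 1)) * saddle c v w 1 := by
  have e1 := h.saddle_atPoint_mul p (digit 0) 1
  have e2 := h.saddle_atPoint_mul q (digit 1) 1
  rw [mul_one] at e1 e2
  rw [map_add, e1, e2, add_mul]

/-- A saddle followed by the reverse saddle is multiplication by `Δ(1)`, placed on the two arcs. -/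
theorem Flip.saddle_comp_saddle {c : Fin L.n} {v w : L.State} (h : Flip c v w) :
    saddle c w v ∘ₗ saddle c v w = LinearMap.mulLeft AlphaRing
      (atPoint v (.inl (c, 0)) (digit 0) + atPoint v (.inl (c, 2)) (digit 1)) := by
  refine linearMap_ext_of_atPoint
    (fun r a y => by
      simp only [LinearMap.comp_apply]
      rw [h.saddle_atPoint_mul, h.symm.saddle_atPoint_mul])
    (fun r a y => by simp only [LinearMap.mulLeft_apply]; ring) ?_
  rw [LinearMap.comp_apply, LinearMap.mulLeft_apply, mul_one]
  -- A split produces `Δ(1)`, which the merge then carries back to `v`; a merge keeps the unit, and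
  -- the split then produces `Δ(1)`.
  by_cases hs : circle v (.inl (c, 0)) = circle v (.inl (c, 2))
  · have hm : circle w (.inl (c, 0)) ≠ circle w (.inl (c, 2)) := fun hw => h.split_iff_not.1 hw hs
    rw [saddle_one_of_split hs, h.symm.saddle_digits, saddle_one_of_merge hm, mul_one]
  · rw [saddle_one_of_merge hs, saddle_one_of_split (h.split_iff_not.2 hs)]

/-- Saddles at different crossings commute, whatever their directions. -/
theorem Flip.saddle_comm {c b : Fin L.n} {v u u' w : L.State} (hu : Flip c v u)
    (hu' : Flip b v u') (hw : Flip b u w) (hw' : Flip c u' w) :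
    saddle b u w ∘ₗ saddle c v u = saddle c u' w ∘ₗ saddle b v u' := by
  refine linearMap_ext_of_atPoint
    (fun r a y => by
      simp only [LinearMap.comp_apply]
      rw [hu.saddle_atPoint_mul, hw.saddle_atPoint_mul])
    (fun r a y => by
      simp only [LinearMap.comp_apply]
      rw [hu'.saddle_atPoint_mul, hw'.saddle_atPoint_mul]) ?_
  simp only [LinearMap.comp_apply]
  have K1 := hu.split_iff_not
  have K2 := hw.split_iff_not
  have K3 := hu'.split_iff_not
  have K4 := hw'.split_iff_not
  -- The hypotheses `s1`, `s2` say whether the saddles on the path through `u` split, and `t1`, `t2`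
  -- do the same for the path through `u'`. In each case both images of the unit are compared in
  -- `w`.
  by_cases s1 : circle v (.inl (c, 0)) = circle v (.inl (c, 2))
  · by_cases s2 : circle u (.inl (b, 0)) = circle u (.inl (b, 2))
    · have t1 := hu.symm.circle_mono s1 s2
      have t2 : circle u' (.inl (c, 0)) = circle u' (.inl (c, 2)) := by
        by_contra h
        exact K1.1 (hw.symm.circle_mono s2 (K4.2 h)) s1
      rw [saddle_one_of_split s1, saddle_one_of_split t1, hw.saddle_digits, hw'.saddle_digits,
        saddle_one_of_split s2, saddle_one_of_split t2, mul_comm]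
    · by_cases t1 : circle v (.inl (b, 0)) = circle v (.inl (b, 2))
      · have t2 : circle u' (.inl (c, 0)) ≠ circle u' (.inl (c, 2)) := by
          intro h
          exact K3.1 (hw'.symm.circle_mono h (K2.2 s2)) t1
        rw [saddle_one_of_split s1, saddle_one_of_split t1, hw.saddle_digits, hw'.saddle_digits,
          saddle_one_of_merge s2, saddle_one_of_merge t2, mul_one, mul_one]
        -- Both paths split and then merge. The saddle at `c` affects whether `b` splits, so both
        -- crossings meet the same circle of `v`. In `w` all the arcs lie on one circle again, and
        -- both images become the sum of the two digits there.
        have hbc : circle v (.inl (b, 0)) = circle v (.inl (c, 0)) := by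
          by_contra h
          exact s2 (circle_of_away hu.2 (circle_crossing_eq s1) t1 h)
        have x2 := K2.2 s2
        have x3 := K4.2 t2
        have x1 : circle w (.inl (b, 0)) = circle w (.inl (c, 0)) ∨
            circle w (.inl (b, 0)) = circle w (.inl (c, 2)) :=
          (hu.circle_eq_or hbc).imp (hw.circle_mono x2) (hw.circle_mono x2)
        rw [atPoint_eq x2.symm, atPoint_eq x3.symm]
        rcases x1 with x1 | x1
        · rw [atPoint_eq x1]
        · rw [atPoint_eq (x1.trans x3.symm)]
      · have t2 : circle u' (.inl (c, 0)) = circle u' (.inl (c, 2)) :=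
          hu'.circle_mono (K3.2 t1) s1
        rw [saddle_one_of_split s1, saddle_one_of_merge t1, hw.saddle_digits,
          saddle_one_of_merge s2, saddle_one_of_split t2, mul_one]
  · by_cases s2 : circle u (.inl (b, 0)) = circle u (.inl (b, 2))
    · rw [saddle_one_of_merge s1, saddle_one_of_split s2]
      by_cases t1 : circle v (.inl (b, 0)) = circle v (.inl (b, 2))
      · have t2 : circle u' (.inl (c, 0)) ≠ circle u' (.inl (c, 2)) := fun h =>
          s1 (hu'.symm.circle_mono t1 h)
        rw [saddle_one_of_split t1, hw'.saddle_digits, saddle_one_of_merge t2, mul_one]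
      · have t2 : circle u' (.inl (c, 0)) = circle u' (.inl (c, 2)) := by
          by_contra h
          exact K2.1 (hw'.circle_mono (K4.2 h) (K3.2 t1)) s2
        rw [saddle_one_of_merge t1, saddle_one_of_split t2]
        -- Both paths merge and then split. The merged circle in `u` passes through `c` and `b`, and
        -- in `w` the arcs at `c` lie on the same two circles as those at `b`, possibly in the other
        -- order, where the symmetry of `Δ(1)` is needed.
        have hbc : circle u (.inl (b, 0)) = circle u (.inl (c, 0)) := by
          by_contra h
          exact t1 (circle_of_away hu.symm.2 (circle_crossing_eq (K1.2 s1)) s2 h)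
        have y0 := hw.circle_eq_or hbc.symm
        have y2 := hw.circle_eq_or ((K1.2 s1).symm.trans hbc.symm)
        have y02 : circle w (.inl (c, 0)) ≠ circle w (.inl (c, 2)) := fun h => K4.1 h t2
        rcases y0 with y0 | y0 <;> rcases y2 with y2 | y2
        · exact absurd (y0.trans y2.symm) y02
        · rw [atPoint_eq y0, atPoint_eq y2]
        · rw [atPoint_eq y0, atPoint_eq y2, atPoint_digit_comm]
        · exact absurd (y0.trans y2.symm) y02
    · have t1 : circle v (.inl (b, 0)) ≠ circle v (.inl (b, 2)) := fun h =>
        s2 (hu.circle_mono (K1.2 s1) h)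
      have t2 : circle u' (.inl (c, 0)) ≠ circle u' (.inl (c, 2)) := fun h =>
        K4.1 (hw.circle_mono (K2.2 s2) (K1.2 s1)) h
      rw [saddle_one_of_merge s1, saddle_one_of_merge t1, saddle_one_of_merge s2,
        saddle_one_of_merge t2]

/-! ### Digits next to a crossing -/

theorem OnEdge.circle_eq {p : L.Point} {d : Dart L.n} (h : OnEdge p d) (v : L.State) :
    circle v p = circle v (.inl d) := by
  rcases h with rfl | rfl
  · rfl
  · exact circle_edge v d

/-- Digits on either side of the crossing `c` amount to `Δ(1)`, placed on the two arcs at `c`. -/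
theorem OnEitherSide.digits_eq {c : Fin L.n} {p q : L.Point} (h : OnEitherSide c p q)
    (v : L.State) :
    atPoint v p (digit 0) + atPoint v q (digit 1) =
      atPoint v (.inl (c, 0)) (digit 0) + atPoint v (.inl (c, 2)) (digit 1) := by
  obtain ⟨i, hp, hq⟩ := h
  rw [atPoint_eq (hp.circle_eq v), atPoint_eq (hq.circle_eq v)]
  -- On the upper strand the `0`-smoothing attaches `1` to `0` and `3` to `2`, while the
  -- `1`-smoothing exchanges these roles.
  have odd : atPoint v (.inl (c, 1)) (digit 0) + atPoint v (.inl (c, 3)) (digit 1) =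
      atPoint v (.inl (c, 0)) (digit 0) + atPoint v (.inl (c, 2)) (digit 1) := by
    cases hc : v c
    · rw [atPoint_eq (circle_arcs_false hc).1, atPoint_eq (circle_arcs_false hc).2]
    · rw [atPoint_eq (circle_arcs_true hc).1, atPoint_eq (circle_arcs_true hc).2,
        atPoint_digit_comm]
  fin_cases i
  · rfl
  · exact odd
  · exact atPoint_digit_comm v _ _
  · exact (atPoint_digit_comm v _ _).trans odd

/-! ### The homotopy -/

/-- The component of the homotopy at the crossing `c` from the summand at `v` to the summand at `w`:
the reverse saddle at `c`, with the sign of the corresponding edge of the cube. -/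
noncomputable def backComponent (c : Fin L.n) (v w : L.State) : Chains v →ₗ[AlphaRing] Chains w :=
  if v c = true ∧ w = Function.update v c false then edgeSign v c • saddle c v w else 0

theorem backComponent_eq_zero {c : Fin L.n} {v w : L.State} (h : degree w + 1 ≠ degree v) :
    backComponent c v w = 0 := by
  refine if_neg ?_
  rintro ⟨hc, rfl⟩
  refine h ?_
  have := degree_update (v := Function.update v c false) (c := c) (by simp)
  rw [← this, Function.update_idem, ← hc, Function.update_eq_self]

theorem edgeSign_mul_self (v : L.State) (c : Fin L.n) : edgeSign v c * edgeSign v c = 1 := by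
  rw [edgeSign, ← mul_pow]; simp

/-- The sign counts only crossings strictly before `c`, so both ends of a cube edge at `c` yield the
same sign. Hence the signs of a saddle and of its reverse multiply to `1`. -/
theorem edgeSign_update_self (v : L.State) (c : Fin L.n) (x : Bool) :
    edgeSign (Function.update v c x) c = edgeSign v c := by
  have : (Finset.univ.filter fun a => a < c ∧ Function.update v c x a = true) =
      Finset.univ.filter fun a => a < c ∧ v a = true := by
    ext a
    by_cases ha : a = c
    · subst ha; simp
    · simp [ha]
  rw [edgeSign, edgeSign, this]

theorem component_update {v : L.State} {c : Fin L.n} (hc : v c = false) :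
    component v (Function.update v c true) =
      edgeSign v c • saddle c v (Function.update v c true) := by
  rw [component, Finset.sum_eq_single c, if_pos ⟨hc, rfl⟩]
  · intro b _ hbc
    refine if_neg ?_
    rintro ⟨hb, h⟩
    have := congrFun h b
    rw [Function.update_of_ne hbc, Function.update_self, hb] at this
    exact Bool.false_ne_true this
  · simp

/-- The crossing `c` is the only one at which an edge of the cube can change it. -/
theorem component_eq_zero_of_ne {v w : L.State} {c : Fin L.n} (hv : v c = false)
    (hw : w c = true) (h : w ≠ Function.update v c true) : component v w = 0 := by
  refine Finset.sum_eq_zero fun b _ => if_neg ?_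
  rintro ⟨-, hb⟩
  by_cases hbc : b = c
  · subst hbc; exact h hb
  · rw [hb, Function.update_of_ne (Ne.symm hbc), hv] at hw
    exact Bool.false_ne_true hw

/-! ### The commutator with the differential, entry by entry -/

/-- The reverse saddle at `c` can reach `w` from one resolution only, so a single intermediate
vertex survives. -/
theorem sum_backComponent_comp (c : Fin L.n) (v w : L.State) :
    ∑ u, backComponent c u w ∘ₗ component v u =
      if w c = false then edgeSign w c • (saddle c (Function.update w c true) w ∘ₗ
        component v (Function.update w c true)) else 0 := by
  by_cases hw : w c = false
  · rw [if_pos hw, Finset.sum_eq_single (Function.update w c true), backComponent, if_pos,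
      LinearMap.smul_comp, edgeSign_update_self]
    · simp [← hw]
    · intro u _ hu
      rw [backComponent, if_neg, LinearMap.zero_comp]
      rintro ⟨huc, rfl⟩
      exact hu (by simp [← huc])
    · simp
  · rw [if_neg hw]
    refine Finset.sum_eq_zero fun u _ => ?_
    rw [backComponent, if_neg, LinearMap.zero_comp]
    rintro ⟨-, rfl⟩
    simp at hw

theorem sum_component_comp (c : Fin L.n) (v w : L.State) :
    ∑ u, component u w ∘ₗ backComponent c v u =
      if v c = true then edgeSign v c • (component (Function.update v c false) w ∘ₗ
        saddle c v (Function.update v c false)) else 0 := by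
  by_cases hv : v c = true
  · rw [if_pos hv, Finset.sum_eq_single (Function.update v c false), backComponent,
      if_pos ⟨hv, rfl⟩, LinearMap.comp_smul]
    · intro u _ hu
      rw [backComponent, if_neg (fun h => hu h.2), LinearMap.comp_zero]
    · simp
  · rw [if_neg hv]
    refine Finset.sum_eq_zero fun u _ => ?_
    rw [backComponent, if_neg (fun h => hv h.1), LinearMap.comp_zero]

/-- The reverse saddle at `c` anticommutes with the saddles at the other crossings. -/
theorem backComponent_anticomm {c : Fin L.n} {v w : L.State} (hv : v c = true)
    (hw : w c = false) :
    edgeSign w c • (saddle c (Function.update w c true) w ∘ₗ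
        component v (Function.update w c true)) +
      edgeSign v c • (component (Function.update v c false) w ∘ₗ
        saddle c v (Function.update v c false)) = 0 := by
  have hv' : Function.update (Function.update v c false) c true = v := by simp [← hv]
  set z := Function.update v c false with hz
  have hzc : z c = false := by simp [hz]
  -- Both composites are expanded over the crossing `b` that the differential changes; they cancel
  -- for each `b` separately.
  have hsum : edgeSign w c • (saddle c (Function.update w c true) w ∘ₗ
        component v (Function.update w c true)) +
      edgeSign v c • (component z w ∘ₗ saddle c v z) =
      ∑ b, (edgeSign w c • (saddle c (Function.update w c true) w ∘ₗ
        (if v b = false ∧ Function.update w c true = Function.update v b true then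
          edgeSign v b • saddle b v (Function.update w c true) else 0)) +
      edgeSign v c • ((if z b = false ∧ w = Function.update z b true then
          edgeSign z b • saddle b z w else 0) ∘ₗ saddle c v z)) := by
    refine LinearMap.ext fun y => ?_
    simp only [component, LinearMap.add_apply, LinearMap.smul_apply, LinearMap.comp_apply,
      LinearMap.sum_apply, map_sum, Finset.sum_add_distrib, Finset.smul_sum]
  rw [hsum]
  refine Finset.sum_eq_zero fun b _ => ?_
  by_cases hb : z b = false ∧ w = Function.update z b true
  · obtain ⟨hzb, hwz⟩ := hb
    have hbc : c ≠ b := by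
      rintro rfl
      rw [hwz, Function.update_self] at hw
      exact Bool.false_ne_true hw.symm
    have hvb : v b = false := by
      rw [← hv', Function.update_of_ne hbc.symm, hzb]
    have hwv : Function.update w c true = Function.update v b true := by
      rw [hwz, Function.update_comm hbc.symm, hv']
    rw [if_pos ⟨hvb, hwv⟩, if_pos ⟨hzb, hwz⟩, LinearMap.comp_smul, LinearMap.smul_comp,
      smul_smul, smul_smul]
    have F1 : Flip c v z := flip_update c (by simp [hv])
    have F2 : Flip b v (Function.update w c true) := by
      rw [hwv]; exact flip_update b (by simp [hvb])
    have F3 : Flip b z w := by rw [hwz]; exact flip_update b (by simp [hzb])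
    have F4 : Flip c (Function.update w c true) w := (flip_update c (by simp [hw])).symm
    rw [F1.saddle_comm F2 F3 F4, ← add_smul]
    have hs := edgeSign_mul hbc hzc hzb
    rw [hv', ← hwz] at hs
    have e1 := edgeSign_mul_self z c
    have e2 := edgeSign_mul_self w c
    have e3 : edgeSign v c = edgeSign z c := (edgeSign_update_self v c false).symm
    -- The relation `hs` is the anticommutation of signs around the face of the cube with lowest
    -- vertex `z`. Since signs square to `1`, multiplying by the signs of the two edges at `c` moves
    -- these to the other side.
    have : edgeSign w c * edgeSign v b + edgeSign v c * edgeSign z b = 0 := by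
      rw [e3]
      linear_combination edgeSign z c * edgeSign w c * hs - edgeSign w c * edgeSign v b * e1 -
        edgeSign z c * edgeSign z b * e2
    rw [this, zero_smul]
  -- If `b` does not complete a face, then it contributes to neither composite.
  · rw [if_neg hb, if_neg]
    · simp
    · rintro ⟨hvb, hwv⟩
      have hbc : c ≠ b := by
        rintro rfl
        rw [hv] at hvb
        exact Bool.false_ne_true hvb.symm
      refine hb ⟨by rw [hz, Function.update_of_ne hbc.symm, hvb], ?_⟩
      rw [hz, Function.update_comm hbc, ← hwv]
      simp [← hw]

/-- The commutator of the differential with the reverse saddle at `c`, by components. -/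
theorem sum_backComponent_add_sum_component (c : Fin L.n) (v w : L.State) :
    ∑ u, backComponent c u w ∘ₗ component v u + ∑ u, component u w ∘ₗ backComponent c v u =
      if w = v then saddle c (Function.update w c (!w c)) w ∘ₗ
        saddle c v (Function.update w c (!w c)) else 0 := by
  rw [sum_backComponent_comp, sum_component_comp]
  -- The reverse saddle must end at a `0`-smoothing of `c` and start at a `1`-smoothing. So with
  -- equal smoothings of `c` in `v` and `w` just one of the two composites survives, and its
  -- differential has to change `c` itself, which forces `w = v`. From `0` to `1` both vanish; from
  -- `1` to `0` they cancel.
  cases hv : v c <;> cases hw : w c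
  · rw [if_pos rfl, if_neg Bool.false_ne_true, add_zero]
    by_cases h : w = v
    · subst h
      rw [if_pos rfl, component_update hw, LinearMap.comp_smul, smul_smul, edgeSign_mul_self,
        one_smul]
      rfl
    · rw [if_neg h, component_eq_zero_of_ne hv (by simp), LinearMap.comp_zero, smul_zero]
      intro h'
      refine h ?_
      -- Resetting `c` to its `0`-smoothing on both sides recovers `w = v`.
      have := congrArg (fun x => Function.update x c false) h'
      simp only [Function.update_idem] at this
      rwa [← hw, Function.update_eq_self, hw, ← hv, Function.update_eq_self] at this
  · have h : w ≠ v := fun h => by rw [h, hv] at hw; exact Bool.false_ne_true hw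
    simp [h]
  · have h : w ≠ v := fun h => by rw [h, hv] at hw; exact Bool.false_ne_true hw.symm
    rw [if_pos rfl, if_pos rfl, if_neg h, backComponent_anticomm hv hw]
  · rw [if_neg (Bool.false_ne_true ∘ Eq.symm), if_pos rfl, zero_add]
    by_cases h : w = v
    · subst h
      have hu : w = Function.update (Function.update w c false) c true := by simp [← hw]
      have := component_update (v := Function.update w c false) (c := c) (by simp)
      rw [← hu] at this
      rw [if_pos rfl, this, LinearMap.smul_comp, smul_smul, edgeSign_update_self,
        edgeSign_mul_self, one_smul]
      rfl
    · rw [if_neg h, component_eq_zero_of_ne (by simp) hw, LinearMap.zero_comp, smul_zero]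
      rw [Function.update_idem, ← hv, Function.update_eq_self]
      exact h

/-! ### Assembly of the homotopy on the complex -/

/-- The homotopy at the crossing `c`. -/
noncomputable def back (c : Fin L.n) (i j : ℤ) : L.ChainsIn i →ₗ[AlphaRing] L.ChainsIn j :=
  LinearMap.pi fun w => ∑ v : {v : L.State // degree v = i},
    backComponent c v.1 w.1 ∘ₗ LinearMap.proj v

theorem back_apply (c : Fin L.n) (i j : ℤ) (x : L.ChainsIn i)
    (w : {w : L.State // degree w = j}) :
    back c i j x w = ∑ v : {v : L.State // degree v = i}, backComponent c v.1 w.1 (x v) := by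
  simp [back]

theorem back_eq_zero {c : Fin L.n} {i j : ℤ} (h : j + 1 ≠ i) : back c i j = 0 := by
  refine LinearMap.ext fun x => funext fun w => ?_
  rw [back_apply]
  refine Finset.sum_eq_zero fun v _ => ?_
  rw [backComponent_eq_zero (by rw [v.2, w.2]; exact h)]
  rfl

/-- This removes the degree restriction on the intermediate vertex, so that the entrywise
commutator, a sum over all resolutions, can be used in a fixed degree. -/
theorem sum_degree_eq {M : Type*} [AddCommMonoid M] (j : ℤ) (f : L.State → M)
    (hf : ∀ u, degree u ≠ j → f u = 0) :
    ∑ u : {u : L.State // degree u = j}, f u.1 = ∑ u, f u := by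
  rw [← Finset.sum_filter_add_sum_filter_not Finset.univ (fun u : L.State => degree u = j),
    Finset.sum_eq_zero (s := Finset.univ.filter fun u : L.State => ¬ degree u = j)
      (fun u hu => hf u (Finset.mem_filter.1 hu).2), add_zero]
  exact (Finset.sum_subtype _ (by simp) f).symm

theorem back_differential_apply (c : Fin L.n) (i : ℤ) (x : L.ChainsIn i)
    (w : {w : L.State // degree w = i}) :
    back c (i + 1) i (L.differential i (i + 1) x) w =
      ∑ v : {v : L.State // degree v = i},
        (∑ u, backComponent c u w.1 ∘ₗ component v.1 u) (x v) := by
  rw [back_apply]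
  simp only [differential_apply, map_sum]
  rw [Finset.sum_comm]
  refine Finset.sum_congr rfl fun v _ => ?_
  rw [LinearMap.sum_apply]
  refine sum_degree_eq (i + 1) (fun u => backComponent c u w.1 (component v.1 u (x v)))
    fun u hu => ?_
  rw [component_eq_zero (by rw [v.2]; exact hu.symm)]
  simp

theorem differential_back_apply (c : Fin L.n) (i : ℤ) (x : L.ChainsIn i)
    (w : {w : L.State // degree w = i}) :
    L.differential (i - 1) i (back c i (i - 1) x) w =
      ∑ v : {v : L.State // degree v = i},
        (∑ u, component u w.1 ∘ₗ backComponent c v.1 u) (x v) := by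
  rw [differential_apply]
  simp only [back_apply, map_sum]
  rw [Finset.sum_comm]
  refine Finset.sum_congr rfl fun v _ => ?_
  rw [LinearMap.sum_apply]
  refine sum_degree_eq (i - 1) (fun u => component u w.1 (backComponent c v.1 u (x v)))
    fun u hu => ?_
  rw [backComponent_eq_zero (by rw [v.2]; intro h; exact hu (by omega))]
  simp

/-- Only the diagonal entries of the commutator are nonzero, and there a saddle followed by its
reverse is multiplication by `Δ(1)` at the two arcs. -/
theorem back_differential_add_differential_back (c : Fin L.n) (i : ℤ) (x : L.ChainsIn i)
    (w : {w : L.State // degree w = i}) :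
    back c (i + 1) i (L.differential i (i + 1) x) w +
        L.differential (i - 1) i (back c i (i - 1) x) w =
      (atPoint w.1 (.inl (c, 0)) (digit 0) + atPoint w.1 (.inl (c, 2)) (digit 1)) * x w := by
  rw [back_differential_apply, differential_back_apply, ← Finset.sum_add_distrib]
  simp only [← LinearMap.add_apply, sum_backComponent_add_sum_component]
  rw [Finset.sum_eq_single w]
  · rw [if_pos rfl, (flip_update c (by simp)).saddle_comp_saddle, LinearMap.mulLeft_apply]
  · intro v _ hv
    rw [if_neg (fun h => hv (Subtype.ext h.symm)), LinearMap.zero_apply]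
  · simp

/-- The homotopy at the crossing `c` as a family of morphisms of the complex. -/
noncomputable def backHom (c : Fin L.n) (i j : ℤ) : L.alphaComplex.X i ⟶ L.alphaComplex.X j :=
  ModuleCat.ofHom (back c i j)

/-- The sum of the two digits on either side of a crossing is null-homotopic. -/
noncomputable def digitsHomotopy {c : Fin L.n} {p q : L.Point} (h : OnEitherSide c p q) :
    Homotopy (L.placeAt (digit 0) p + L.placeAt (digit 1) q) 0 where
  hom := backHom c
  zero i j hij := by
    rw [backHom, back_eq_zero (by simpa using hij)]
    rfl
  comm i := by
    -- The terms of the homotopy relation at `i` pass through degrees `i + 1` and `i - 1`, as in the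
    -- commutator formula.
    rw [dNext_eq _ (show (ComplexShape.up ℤ).Rel i (i + 1) from rfl),
      prevD_eq _ (show (ComplexShape.up ℤ).Rel (i - 1) i from sub_add_cancel i 1)]
    refine ModuleCat.hom_ext (LinearMap.ext fun x => funext fun w => ?_)
    have key := back_differential_add_differential_back c i x w
    -- On every resolution `Δ(1)` at the arcs of `c` is replaced by the digits at `p` and `q`.
    rw [← h.digits_eq w.1, add_mul] at key
    refine key.symm.trans ?_
    rw [HomologicalComplex.zero_f, add_zero]
    rfl

end LinkDiagram

/-! ### Passage to homology -/

theorem mainTheorem11 (L : LinkDiagram) (c : Fin L.n) (p q : L.Point)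
    (hpq : LinkDiagram.OnEitherSide c p q) (i : ℤ) :
    L.digitMap 0 p i + L.digitMap 1 q i = 0 := by
  rw [LinkDiagram.digitMap, LinkDiagram.digitMap, ← HomologicalComplex.homologyMap_add,
    (LinkDiagram.digitsHomotopy hpq).homologyMap_eq, HomologicalComplex.homologyMap_zero]
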